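/- Let $k$ be an algebraically closed field and let $\Gamma$ be a finite acyclic quiver with vertex set $\Gamma_0$; paths are composed from left to right. For each $l\in\Gamma_0$ let $A_l\cong k\Sigma_l/\Omega_l$ be an algebra presented by a finite quiver $\Sigma_l$ and an admissible ideal $\Omega_l$. Let $k(\Gamma,\mathcal A)$ be the generalized path algebra: it is spanned by the sequences $a_1\beta_1a_2\cdots a_n\beta_na_{n+1}$ with $\beta_1\cdots\beta_n$ a path of $\Gamma$, $a_l\in A_{s(\beta_l)}$, $a_{n+1}\in A_{e(\beta_n)}$ (and, for $n=0$, by the elements of the $A_l$), which are $k$-linear in each $a_l$ and are multiplied by concatenation and by the multiplications of the $A_l$. In other words, it is the tensor algebra over $A_{\mathcal A}=\prod_l A_l$ of the bimodule generated by the arrows. Let $I$ be a set of relations (linear combinations of paths of length at least $2$ with common start and common end) that generates an admissible ideal of $k\Gamma$. Let $\Lambda=k(\Gamma,\mathcal A,I)$ be the quotient of $k(\Gamma,\mathcal A)$ by the ideal generated by all elements $\sum_t\lambda_t\,\beta_{t1}\overline{\gamma_{t1}}\beta_{t2}\cdots\overline{\gamma_{t,m_t-1}}\beta_{tm_t}$,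 where $\sum_t\lambda_t\beta_{t1}\cdots\beta_{tm_t}\in I$ and $\gamma_{tl}$ is any path of $\Sigma_{e(\beta_{tl})}$, with class $\overline{\gamma_{tl}}$ in $A_{e(\beta_{tl})}$. Modules are right modules. Write $1_j$ for the identity of $A_j$, viewed in $\Lambda$. The representation of a $\Lambda$-module $N$ consists of the $A_j$-modules $N_j=N\cdot 1_j$ $(j\in\Gamma_0)$ and of the $k$-linear maps $\phi_\alpha:N_j\to N_{j'}$, $x\mapsto x\alpha$, for the arrows $\alpha:j\to j'$. Let $i\in\Gamma_0$ and let $M$ be a finitely generated $A_i$-module, with $k$-basis $(m_p)_p$. Regard $M$ as an $A_{\mathcal A}$-module through the component $A_i$. For each $l$ let $(a^l_c)_c$ be a $k$-basis of $A_l$. Let $((M_j)_j,(\phi_\alpha)_\alpha)$ be the representation of the cone $\mathcal C_i(M)=M\otimes_{A_{\mathcal A}}\Lambda$. For $j\ne i$ consider the formal sequences $$\sigma=m_p\,\gamma_1\,a^{s(\gamma_2)}_{i_2}\,\gamma_2\cdots a^{s(\gamma_r)}_{i_r}\,\gamma_r ,$$ where $r\ge 1$ and $\gamma_1\cdots\gamma_r$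 is a path from $i$ to $j$, and let $\overline\sigma=m_p\otimes\overline{\gamma_1a_{i_2}^{s(\gamma_2)}\gamma_2\cdots a_{i_r}^{s(\gamma_r)}\gamma_r}\in M_j$ be the class of $\sigma$. Then: 1. $m\mapsto m\otimes 1$ is an isomorphism $M\to M_i$ of $A_i$-modules. 2. If $j\neq i$, then $M_j$ is the free $A_j$-module on the classes of the formal sequences from $i$ to $j$, taken modulo the $k$-linear relations between them. That is, there are sets $S$ of formal sequences whose classes $(\overline\sigma)_{\sigma\in S}$ form a $k$-basis of the $k$-span of all the classes, and for every such $S$ the family $(\overline\sigma)_{\sigma\in S}$ is a basis of the $A_j$-module $M_j$. In particular, suppose that every element of $I$ is a nonzero scalar multiple of a path (for example $I=\emptyset$). Then $\overline\sigma=0$ for every $\sigma$ whose path $\gamma_1\cdots\gamma_r$ contains a path occurring in $I$ as a subpath, and the family of the classes of all the other formal sequences is a basis of the $A_j$-module $M_j$. 3. If $\alpha:j\to j'$ is an arrow with $j\ne i$, then $\phi_\alpha$ is the only $k$-linear map $M_j\to M_{j'}$ such that $$\phi_\alpha\bigl(\overline{m_p\gamma_1a_{i_2}^{s(\gamma_2)}\cdots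 a_{i_r}^{s(\gamma_r)}\gamma_r}\;a^j_c\bigr)=\overline{m_p\gamma_1a_{i_2}^{s(\gamma_2)}\cdots a_{i_r}^{s(\gamma_r)}\gamma_r\,a^j_c\,\alpha}$$ for all these formal sequences and all $c$. If $\alpha:i\to j'$ is an arrow, then $\phi_\alpha$ is the only $k$-linear map $M_i\to M_{j'}$ such that $\phi_\alpha(m_p\otimes 1)=\overline{m_p\alpha}$ for all $p$. -/

import Mathlib

open MulOpposite TensorProduct

noncomputable section

namespace GBP

universe u v w x

section Inclusion

variable {V : Type u} {A : V → Type x} [∀ i, Ring (A i)]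

/-- The inclusion of `A_i` in the product algebra `∏ A_l`; the idempotent `1_i` is `inc i 1`. -/
def inc (i : V) (a : A i) : ∀ l, A l :=
  open scoped Classical in Pi.single i a

theorem inc_mul (i : V) (a b : A i) : (inc i (a * b) : ∀ l, A l) = inc i a * inc i b := by
  classical
  unfold inc
  convert Pi.single_mul i a b

theorem inc_add (i : V) (a b : A i) : (inc i (a + b) : ∀ l, A l) = inc i a + inc i b := by
  classical
  unfold inc
  convert Pi.single_add i a b

theorem inc_zero (i : V) : (inc i (0 : A i) : ∀ l, A l) = 0 := by
  classical
  unfold inc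
  convert Pi.single_zero i

end Inclusion

/-! ### Generalized path algebras

Right modules over an algebra `R` are modules over `Rᵐᵒᵖ`, so `op r • x` is `x · r`.
Paths are composed from left to right. -/

section GeneralizedPathAlgebra

variable (k : Type w) [Field k] {V : Type u} [Quiver.{v} V] (A : V → Type x)
  [∀ i, Ring (A i)] [∀ i, Algebra k (A i)]

/-- The arrows of a quiver. -/
abbrev Arrow (V : Type u) [Quiver.{v} V] : Type (max u v) := Σ i j : V, (i ⟶ j)

/-- The free algebra on the elements of `A_𝒜 = ∏ A_i` and on the arrows. -/
abbrev FreeGPA : Type (max u v w x) := FreeAlgebra k ((∀ i, A i) ⊕ Arrow V)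

/-- The defining relations of the generalized path algebra: the elements of `∏ A_i`
multiply and add as they do there, and an arrow `α : i ⟶ j` satisfies `1_i α 1_j = α`. -/
inductive GPARel : FreeGPA k A → FreeGPA k A → Prop
  | add (a b : ∀ i, A i) : GPARel (FreeAlgebra.ι k (Sum.inl a) + FreeAlgebra.ι k (Sum.inl b))
      (FreeAlgebra.ι k (Sum.inl (a + b)))
  | mul (a b : ∀ i, A i) : GPARel (FreeAlgebra.ι k (Sum.inl a) * FreeAlgebra.ι k (Sum.inl b))
      (FreeAlgebra.ι k (Sum.inl (a * b)))
  | scalar (c : k) : GPARel (FreeAlgebra.ι k (Sum.inl (algebraMap k (∀ i, A i) c)))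
      (algebraMap k (FreeGPA k A) c)
  | arrow {i j : V} (α : i ⟶ j) : GPARel
      (FreeAlgebra.ι k (Sum.inl (inc i 1)) * FreeAlgebra.ι k (Sum.inr ⟨i, j, α⟩) *
        FreeAlgebra.ι k (Sum.inl (inc j 1)))
      (FreeAlgebra.ι k (Sum.inr ⟨i, j, α⟩))

/-- The generalized path algebra `k(Γ, 𝒜)` of a finite quiver: the tensor algebra over
`A_𝒜 = ∏ A_i` of the `A_𝒜`-bimodule generated by the arrows `α` subject to `1_{s(α)} α 1_{e(α)} = α`
(and with scalars acting alike on both sides). It is spanned by the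
`𝒜`-paths `a_1 β_1 a_2 ⋯ a_n β_n a_{n+1}`, which are `k`-linear in each `a_l` and are multiplied by
concatenation and by the multiplications of the `A_i`. -/
def GPA : Type (max u v w x) := RingQuot (GPARel k A)

instance : Ring (GPA k A) := inferInstanceAs (Ring (RingQuot (GPARel k A)))

instance : Algebra k (GPA k A) := inferInstanceAs (Algebra k (RingQuot (GPARel k A)))

/-- The quotient map from the free algebra. -/
def GPA.mk : FreeGPA k A →ₐ[k] GPA k A := RingQuot.mkAlgHom k (GPARel k A)

theorem GPA.mk_rel {a b : FreeGPA k A} (h : GPARel k A a b) : GPA.mk k A a = GPA.mk k A b :=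
  RingQuot.mkAlgHom_rel k h

/-- The algebra homomorphism from `A_𝒜 = ∏ A_i` to `k(Γ, 𝒜)`. -/
def GPA.base : (∀ i, A i) →ₐ[k] GPA k A where
  toFun a := GPA.mk k A (FreeAlgebra.ι k (Sum.inl a))
  map_one' := by
    have h := GPA.mk_rel k A (GPARel.scalar (1 : k))
    simpa using h
  map_mul' a b := by
    have h := GPA.mk_rel k A (GPARel.mul a b)
    rw [map_mul] at h
    exact h.symm
  map_zero' := by
    have h := GPA.mk_rel k A (GPARel.scalar (0 : k))
    simpa using h
  map_add' a b := by
    have h := GPA.mk_rel k A (GPARel.add a b)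
    rw [map_add] at h
    exact h.symm
  commutes' c := by
    have h := GPA.mk_rel k A (GPARel.scalar c)
    rw [AlgHom.commutes] at h
    exact h

/-- An arrow as an element of `k(Γ, 𝒜)`. -/
def GPA.arrow {i j : V} (α : i ⟶ j) : GPA k A := GPA.mk k A (FreeAlgebra.ι k (Sum.inr ⟨i, j, α⟩))

theorem GPA.base_mul_arrow {i j : V} (α : i ⟶ j) :
    GPA.base k A (inc i 1) * GPA.arrow k A α * GPA.base k A (inc j 1) = GPA.arrow k A α := by
  have h := GPA.mk_rel k A (GPARel.arrow α)
  rw [map_mul, map_mul] at h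
  exact h

end GeneralizedPathAlgebra

/-! ### Path algebras, relations and admissible ideals -/

section PathAlgebra

variable (k : Type w) [Field k] (Q : Type u) [Quiver.{v} Q]

/-- The ordinary path algebra `kQ`: every vertex carries the algebra `k`. -/
abbrev PathAlgebra : Type (max u v w) := GPA k (fun _ : Q => k)

variable {Q}

/-- A path as an element of the path algebra; the path of length `0` at `i` is `1_i`. -/
def pathElem : {i j : Q} → Quiver.Path i j → PathAlgebra k Q
  | i, _, .nil => GPA.base k (fun _ : Q => k) (inc i 1)
  | _, _, .cons p α => pathElem p * GPA.arrow k (fun _ : Q => k) α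

variable (Q) in
/-- The `m`-th power of the ideal of `kQ` generated by the arrows: the span of the paths of length
at least `m`. -/
def arrowIdealPow (m : ℕ) : Submodule k (PathAlgebra k Q) :=
  Submodule.span k {z | ∃ (i j : Q) (p : Quiver.Path i j), m ≤ p.length ∧ z = pathElem k p}

/-- An ideal `J` of `kQ` is admissible if `R ^ m ⊆ J ⊆ R ^ 2` for some `m ≥ 2`, where `R` is the
ideal generated by the arrows. -/
def IsAdmissible (J : TwoSidedIdeal (PathAlgebra k Q)) : Prop :=
  (∃ m : ℕ, 2 ≤ m ∧ ∀ z ∈ arrowIdealPow k Q m, z ∈ J) ∧ ∀ z ∈ J, z ∈ arrowIdealPow k Q 2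

variable (Q) in
/-- A relation: a linear combination of paths of length at least two with the same start and the
same end. -/
structure Relation where
  src : Q
  tgt : Q
  /-- the coefficients of the paths -/
  coeff : Quiver.Path src tgt →₀ k
  two_le : ∀ p ∈ coeff.support, 2 ≤ p.length

/-- A relation as an element of the path algebra. -/
def Relation.toElem {k : Type w} [Field k] {Q : Type u} [Quiver.{v} Q] (ρ : Relation k Q) :
    PathAlgebra k Q :=
  ρ.coeff.sum fun p c => c • pathElem k p

/-- The ideal of `kQ` generated by a set of relations. -/
def relationIdeal {k : Type w} [Field k] {Q : Type u} [Quiver.{v} Q] (I : Set (Relation k Q)) :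
    TwoSidedIdeal (PathAlgebra k Q) :=
  TwoSidedIdeal.span (Relation.toElem '' I)

/-- A quiver is acyclic if it has no oriented cycle. -/
def IsAcyclicQuiver (Q : Type u) [Quiver.{v} Q] : Prop :=
  ∀ (i : Q) (p : Quiver.Path i i), p.length = 0

/-- A presentation `A ≅ kΣ / Ω` of an algebra `A` by a finite quiver `Σ` and an admissible ideal
`Ω` of `kΣ`, the kernel of the surjection `kΣ → A`. Over an algebraically closed field, the algebras
that have one are the basic finite-dimensional ones. -/
structure BoundPresentation (k : Type w) [Field k] (A : Type x) [Ring A] [Algebra k A] where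
  /-- the vertices of `Σ` -/
  vertices : Type u
  [quiver : Quiver.{v} vertices]
  [finite_vertices : Finite vertices]
  [finite_arrows : ∀ a b : vertices, Finite (a ⟶ b)]
  /-- the surjection `kΣ → A` -/
  proj : PathAlgebra k vertices →ₐ[k] A
  surjective : Function.Surjective proj
  admissible : IsAdmissible k (TwoSidedIdeal.ker proj)

attribute [instance] BoundPresentation.quiver

end PathAlgebra

/-! ### Generalized bound path algebras -/

section Bound

universe u' v'

variable {k : Type w} [Field k] {V : Type u} [Quiver.{v} V] {A : V → Type x}
  [∀ i, Ring (A i)] [∀ i, Algebra k (A i)]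
  (P : ∀ i, BoundPresentation.{u', v'} k (A i))

/-- `IsInterleaving P p z`: for the path `p = β_1 ⋯ β_m`, `m ≥ 1`, of `Γ`, the element `z` of
`k(Γ, 𝒜)` is of the form `β_1 γ_1 β_2 ⋯ γ_{m-1} β_m`, where `γ_l` is (the class in `A_{e(β_l)}` of) a
path of the quiver `Σ_{e(β_l)}`. -/
inductive IsInterleaving : {i j : V} → Quiver.Path i j → GPA k A → Prop
  | single {i j : V} (β : i ⟶ j) : IsInterleaving (Quiver.Path.nil.cons β) (GPA.arrow k A β)
  | cons {i j l : V} (p : Quiver.Path i j) (z : GPA k A) (β : j ⟶ l)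
      {a b : (P j).vertices} (γ : Quiver.Path a b) (h : IsInterleaving p z) :
      IsInterleaving (p.cons β)
        (z * GPA.base k A (inc j ((P j).proj (pathElem k γ))) * GPA.arrow k A β)

/-- The set `𝒜(I)`: from each relation of `I` one gets its elements by interleaving each of its
paths with paths of the quivers `Σ_l`, chosen independently. -/
def boundSet (I : Set (Relation k V)) : Set (GPA k A) :=
  {z | ∃ ρ ∈ I, ∃ f : Quiver.Path ρ.src ρ.tgt → GPA k A,
    (∀ p ∈ ρ.coeff.support, IsInterleaving P p (f p)) ∧ z = ρ.coeff.sum fun p c => c • f p}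

variable (I : Set (Relation k V))

/-- The generalized bound path algebra `Λ = k(Γ, 𝒜, I)`: the quotient of `k(Γ, 𝒜)` by the ideal
generated by `𝒜(I)`. -/
def BoundGPA : Type (max u v w x) := RingQuot fun y z : GPA k A => y ∈ boundSet P I ∧ z = 0

instance : Ring (BoundGPA P I) :=
  inferInstanceAs (Ring (RingQuot fun y z : GPA k A => y ∈ boundSet P I ∧ z = 0))

instance : Algebra k (BoundGPA P I) :=
  inferInstanceAs (Algebra k (RingQuot fun y z : GPA k A => y ∈ boundSet P I ∧ z = 0))

/-- The quotient map `k(Γ, 𝒜) → Λ`. -/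
def BoundGPA.mk : GPA k A →ₐ[k] BoundGPA P I :=
  RingQuot.mkAlgHom k fun y z : GPA k A => y ∈ boundSet P I ∧ z = 0

/-- The algebra homomorphism from `A_𝒜 = ∏ A_i` to `Λ`. -/
def BoundGPA.base : (∀ i, A i) →ₐ[k] BoundGPA P I := (BoundGPA.mk P I).comp (GPA.base k A)

/-- The element of `Λ` given by an element of `A_i`. -/
def BoundGPA.elem (i : V) (a : A i) : BoundGPA P I := BoundGPA.base P I (inc i a)

/-- The element of `Λ` given by an arrow. -/
def BoundGPA.arrow {i j : V} (α : i ⟶ j) : BoundGPA P I := BoundGPA.mk P I (GPA.arrow k A α)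

theorem BoundGPA.elem_mul (i : V) (a b : A i) :
    BoundGPA.elem P I i (a * b) = BoundGPA.elem P I i a * BoundGPA.elem P I i b := by
  rw [elem, inc_mul, map_mul]; rfl

theorem BoundGPA.elem_add (i : V) (a b : A i) :
    BoundGPA.elem P I i (a + b) = BoundGPA.elem P I i a + BoundGPA.elem P I i b := by
  rw [elem, inc_add, map_add]; rfl

theorem BoundGPA.elem_zero (i : V) : BoundGPA.elem P I i 0 = 0 := by
  rw [elem, inc_zero, map_zero]

theorem BoundGPA.arrow_mul_elem {i j : V} (α : i ⟶ j) :
    BoundGPA.arrow P I α * BoundGPA.elem P I j 1 = BoundGPA.arrow P I α := by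
  have hi : GPA.base k A (inc j 1) * GPA.base k A (inc j 1) = GPA.base k A (inc j 1) := by
    rw [← map_mul, ← inc_mul, one_mul]
  have h : GPA.arrow k A α * GPA.base k A (inc j 1) = GPA.arrow k A α := by
    conv_lhs => rw [← GPA.base_mul_arrow k A α]
    rw [mul_assoc, hi, GPA.base_mul_arrow]
  change BoundGPA.mk P I (GPA.arrow k A α) * BoundGPA.mk P I (GPA.base k A (inc j 1)) =
    BoundGPA.mk P I (GPA.arrow k A α)
  rw [← map_mul, h]

/-! ### The representation of a `Λ`-module -/

section Representation

variable (N : Type*) [AddCommGroup N] [Module k N] [Module (BoundGPA P I)ᵐᵒᵖ N]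
  [IsScalarTower k (BoundGPA P I)ᵐᵒᵖ N]

/-- The subspace `N · 1_j` of a right `Λ`-module `N`. -/
def vertexSpace (j : V) : Submodule k N where
  carrier := {x | ∃ y : N, op (BoundGPA.elem P I j 1) • y = x}
  add_mem' := by
    rintro _ _ ⟨y, rfl⟩ ⟨z, rfl⟩
    exact ⟨y + z, smul_add _ _ _⟩
  zero_mem' := ⟨0, smul_zero _⟩
  smul_mem' := by
    rintro c _ ⟨y, rfl⟩
    exact ⟨c • y, smul_algebra_smul_comm _ _ _⟩

/-- The right `A_j`-module `N_j = N · 1_j` at the vertex `j` of the representation of `N`. -/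
def VertexModule (j : V) : Type _ := vertexSpace P I N j

variable {N}

theorem smul_elem_mem (j : V) (a : A j) (y : N) :
    op (BoundGPA.elem P I j a) • y ∈ vertexSpace P I N j :=
  ⟨op (BoundGPA.elem P I j a) • y, by
    rw [← mul_smul, ← op_mul, ← BoundGPA.elem_mul, mul_one]⟩

theorem smul_arrow_mem {i j : V} (α : i ⟶ j) (y : N) :
    op (BoundGPA.arrow P I α) • y ∈ vertexSpace P I N j :=
  ⟨op (BoundGPA.arrow P I α) • y, by
    rw [← mul_smul, ← op_mul, BoundGPA.arrow_mul_elem]⟩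

theorem elem_one_smul (j : V) (y : vertexSpace P I N j) :
    op (BoundGPA.elem P I j 1) • (y : N) = y := by
  obtain ⟨_, z, rfl⟩ := y
  change op (BoundGPA.elem P I j 1) • (op (BoundGPA.elem P I j 1) • z) = _
  rw [← mul_smul, ← op_mul, ← BoundGPA.elem_mul, mul_one]

variable (N)

instance (j : V) : AddCommGroup (VertexModule P I N j) :=
  inferInstanceAs (AddCommGroup (vertexSpace P I N j))

instance (j : V) : Module k (VertexModule P I N j) :=
  inferInstanceAs (Module k (vertexSpace P I N j))

variable {N}

/-- The inclusion of `N_j = N · 1_j` in `N`. -/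
def VertexModule.val (j : V) : VertexModule P I N j →ₗ[k] N := (vertexSpace P I N j).subtype

instance (j : V) : Module (A j)ᵐᵒᵖ (VertexModule P I N j) where
  smul a y := (⟨op (BoundGPA.elem P I j a.unop) • VertexModule.val P I j y,
    smul_elem_mem P I j a.unop _⟩ : vertexSpace P I N j)
  one_smul y := Subtype.ext (elem_one_smul P I j y)
  mul_smul a b y := Subtype.ext (by
    change op (BoundGPA.elem P I j (b.unop * a.unop)) • VertexModule.val P I j y =
      op (BoundGPA.elem P I j a.unop) • op (BoundGPA.elem P I j b.unop) • VertexModule.val P I j y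
    rw [BoundGPA.elem_mul, op_mul, mul_smul])
  smul_zero a := Subtype.ext (smul_zero (op (BoundGPA.elem P I j a.unop)))
  smul_add a y z := Subtype.ext (smul_add (op (BoundGPA.elem P I j a.unop))
    (VertexModule.val P I j y) (VertexModule.val P I j z))
  add_smul a b y := Subtype.ext (by
    change op (BoundGPA.elem P I j (a.unop + b.unop)) • VertexModule.val P I j y =
      op (BoundGPA.elem P I j a.unop) • VertexModule.val P I j y +
      op (BoundGPA.elem P I j b.unop) • VertexModule.val P I j y
    rw [BoundGPA.elem_add, op_add, add_smul])
  zero_smul y := Subtype.ext (by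
    change op (BoundGPA.elem P I j 0) • VertexModule.val P I j y = 0
    rw [BoundGPA.elem_zero, op_zero, zero_smul])

/-- The linear map `φ_α : N_i → N_j`, `x ↦ x · α`, at the arrow `α : i ⟶ j` of the representation
of `N`. -/
def arrowMap {i j : V} (α : i ⟶ j) : VertexModule P I N i →ₗ[k] VertexModule P I N j where
  toFun y := (⟨op (BoundGPA.arrow P I α) • VertexModule.val P I i y,
    smul_arrow_mem P I α _⟩ : vertexSpace P I N j)
  map_add' y z := Subtype.ext (smul_add (op (BoundGPA.arrow P I α))
    (VertexModule.val P I i y) (VertexModule.val P I i z))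
  map_smul' c y := Subtype.ext (smul_algebra_smul_comm c (op (BoundGPA.arrow P I α))
    (VertexModule.val P I i y))

end Representation

/-! ### Cones -/

section Cone

variable (i : V) (M : Type*) [AddCommGroup M] [Module k M] [Module (A i)ᵐᵒᵖ M]

/-- The relations `(m · a) ⊗ l = m ⊗ (a l)` of the tensor product over `A_𝒜 = ∏ A_l`, which acts on
`M` through its component `A_i`. The two factors are written in the order `l ⊗ m`, so that the right
action of `Λ` on the first factor is the one that Mathlib puts on `Λ ⊗[k] M`. -/
def coneRelations : Submodule (BoundGPA P I)ᵐᵒᵖ (BoundGPA P I ⊗[k] M) :=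
  Submodule.span _ {t | ∃ (m : M) (a : ∀ l, A l) (l : BoundGPA P I),
    t = l ⊗ₜ[k] (op (a i) • m) - (BoundGPA.base P I a * l) ⊗ₜ[k] m}

/-- The cone `𝒞_i(M) = M ⊗_{A_𝒜} Λ`, a right `Λ`-module. -/
def Cone : Type _ := (BoundGPA P I ⊗[k] M) ⧸ coneRelations P I i M

instance : AddCommGroup (Cone P I i M) :=
  inferInstanceAs (AddCommGroup ((BoundGPA P I ⊗[k] M) ⧸ coneRelations P I i M))

instance : Module (BoundGPA P I)ᵐᵒᵖ (Cone P I i M) :=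
  inferInstanceAs (Module (BoundGPA P I)ᵐᵒᵖ ((BoundGPA P I ⊗[k] M) ⧸ coneRelations P I i M))

instance : Module k (Cone P I i M) :=
  inferInstanceAs (Module k ((BoundGPA P I ⊗[k] M) ⧸ coneRelations P I i M))

instance : IsScalarTower k (BoundGPA P I)ᵐᵒᵖ (Cone P I i M) :=
  inferInstanceAs (IsScalarTower k (BoundGPA P I)ᵐᵒᵖ
    ((BoundGPA P I ⊗[k] M) ⧸ coneRelations P I i M))

variable {M}

/-- The element `m ⊗ l` of the cone. -/
def Cone.tmul (m : M) (l : BoundGPA P I) : Cone P I i M :=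
  Submodule.Quotient.mk (p := coneRelations P I i M) (l ⊗ₜ[k] m)

end Cone

/-! ### Formal sequences -/

/-- `Word κ i j`: the formal sequences `γ_1 a_2 γ_2 ⋯ a_r γ_r`, `r ≥ 1`, where `γ_1 ⋯ γ_r` is a path
from `i` to `j` and `a_l` is an index in `κ (s(γ_l))`; here `κ l` indexes a basis of `A_l`. -/
inductive Word (κ : V → Type*) (i : V) : V → Type _
  | single {j : V} (α : i ⟶ j) : Word κ i j
  | snoc {j l : V} (s : Word κ i j) (c : κ j) (α : j ⟶ l) : Word κ i l

/-- The path `γ_1 ⋯ γ_r` that underlies a formal sequence. -/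
def Word.path {κ : V → Type*} {i : V} : {j : V} → Word κ i j → Quiver.Path i j
  | _, .single α => Quiver.Path.nil.cons α
  | _, .snoc s _ α => s.path.cons α

/-- The class of a formal sequence in `Λ`. -/
def Word.elem {κ : V → Type*} (b : ∀ l, Module.Basis (κ l) k (A l)) {i : V} :
    {j : V} → Word κ i j → BoundGPA P I
  | _, .single α => BoundGPA.arrow P I α
  | _, .snoc (j := j) s c α => s.elem b * BoundGPA.elem P I j (b j c) * BoundGPA.arrow P I α

theorem Word.elem_mul_one {κ : V → Type*} (b : ∀ l, Module.Basis (κ l) k (A l)) {i j : V}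
    (s : Word κ i j) : s.elem P I b * BoundGPA.elem P I j 1 = s.elem P I b := by
  cases s with
  | single α => exact BoundGPA.arrow_mul_elem P I α
  | snoc s c α => rw [Word.elem, mul_assoc, BoundGPA.arrow_mul_elem]

/-- The class `m_p γ_1 a_2 γ_2 ⋯ a_r γ_r` of a formal sequence in `𝒞_i(M)_j = 𝒞_i(M) · 1_j`. -/
def seqClass {κ : V → Type*} (b : ∀ l, Module.Basis (κ l) k (A l)) {i : V} {M : Type*}
    [AddCommGroup M] [Module k M] [Module (A i)ᵐᵒᵖ M] {τ : Type*} (μ : Module.Basis τ k M) {j : V}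
    (s : τ × Word κ i j) : VertexModule P I (Cone P I i M) j :=
  (⟨Cone.tmul P I i (μ s.1) (s.2.elem P I b), Cone.tmul P I i (μ s.1) (s.2.elem P I b), by
    change Submodule.Quotient.mk (op (BoundGPA.elem P I j 1) • (s.2.elem P I b ⊗ₜ[k] μ s.1)) = _
    rw [TensorProduct.smul_tmul', op_smul_eq_mul, Word.elem_mul_one]
    rfl⟩ : vertexSpace P I (Cone P I i M) j)

/-- The path `p` has a subpath that belongs to a relation of `I` (with a nonzero coefficient). -/
def ContainsRelationPath (I : Set (Relation k V)) {i j : V} (p : Quiver.Path i j) : Prop :=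
  ∃ ρ ∈ I, ∃ q ∈ ρ.coeff.support, ∃ (y : Quiver.Path i ρ.src) (z : Quiver.Path ρ.tgt j),
    p = (y.comp q).comp z

/-- Every relation of `I` is a nonzero scalar multiple of a path. -/
def IsMonomial (I : Set (Relation k V)) : Prop :=
  ∀ ρ ∈ I, ∃ (q : Quiver.Path ρ.src ρ.tgt) (c : k), c ≠ 0 ∧ ρ.coeff = Finsupp.single q c

end Bound

end GBP

end

/-!
A right Fox derivation `Θ` on the cone takes values in `∏ A_l`, vanishes on `M`, is linear over
`∏ A_l` acting on the right, and sends `x · α` to `c_α(x) · 1_{e(α)}` for prescribed `k`-linear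
functionals `c_α`, one for each arrow `α`. It exists as soon as the `c_α` respect the relations.

For a functional `f` take `c_α(x) = f(x · α)`. All the paths of a relation end at one vertex, so
this choice respects the relations, and `Θ(σ̄ · a) = f(σ̄) · a` for every formal sequence `σ`.
Functionals dual over `k` to a family of classes thus become dual over `A_j`, and `k`-independent
classes are `A_j`-independent. They generate `M_j` because `M ⊗ 1` generates the cone.

For monomial relations, a functional dual to a formal sequence `σ = s a_c α` that avoids the
relations is built by recursion along `σ`: take `c_β = 0` for `β ≠ α`, and for `c_α` the `c`-th
coordinate of the `A`-valued functional dual to `s`.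
-/

namespace GBP

section Inclusion

variable {V : Type*} {A : V → Type*} [∀ i, Ring (A i)]

theorem inc_same (i : V) (a : A i) : inc i a i = a := by
  classical
  unfold inc
  convert Pi.single_eq_same i a

theorem inc_of_ne {i j : V} (h : j ≠ i) (a : A i) : inc i a j = 0 := by
  classical
  unfold inc
  convert Pi.single_eq_of_ne h a

theorem inc_mul_pi (i : V) (a : A i) (x : ∀ l, A l) : inc i a * x = inc i (a * x i) := by
  funext j
  by_cases h : j = i
  · subst h
    simp [inc_same]
  · simp [inc_of_ne h]

theorem pi_mul_inc (i : V) (x : ∀ l, A l) (a : A i) : x * inc i a = inc i (x i * a) := by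
  funext j
  by_cases h : j = i
  · subst h
    simp [inc_same]
  · simp [inc_of_ne h]

theorem inc_smul {k : Type*} [Field k] [∀ i, Algebra k (A i)] (i : V) (c : k) (a : A i) :
    (inc i (c • a) : ∀ l, A l) = c • inc i a := by
  funext j
  by_cases h : j = i
  · subst h
    simp [inc_same]
  · simp [inc_of_ne h]

theorem inc_mul_inc_of_ne {i j : V} (h : i ≠ j) (a : A i) (b : A j) :
    (inc i a : ∀ l, A l) * inc j b = 0 := by
  rw [inc_mul_pi, inc_of_ne h, mul_zero, inc_zero]

theorem sum_inc [Fintype V] (x : ∀ l, A l) : ∑ l, inc l (x l) = x := by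
  funext j
  rw [Finset.sum_apply, Finset.sum_eq_single j, inc_same]
  · exact fun l _ h => inc_of_ne h.symm _
  · simp

end Inclusion

section GeneralizedPathAlgebra

variable {k : Type*} [Field k] {V : Type*} [Quiver V] {A : V → Type*}
  [∀ i, Ring (A i)] [∀ i, Algebra k (A i)]

theorem GPA.mk_surjective : Function.Surjective (GPA.mk k A) :=
  RingQuot.mkAlgHom_surjective k (GPARel k A)

@[elab_as_elim]
theorem GPA.induction {C : GPA k A → Prop} (base : ∀ a, C (GPA.base k A a))
    (arrow : ∀ {i j : V} (α : i ⟶ j), C (GPA.arrow k A α))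
    (mul : ∀ x y, C x → C y → C (x * y)) (add : ∀ x y, C x → C y → C (x + y)) (x : GPA k A) :
    C x := by
  obtain ⟨y, rfl⟩ := GPA.mk_surjective x
  induction y using FreeAlgebra.induction with
  | grade0 c =>
    rw [AlgHom.commutes, ← AlgHom.commutes (GPA.base k A)]
    exact base _
  | grade1 g =>
    rcases g with a | ⟨i, j, α⟩
    · exact base a
    · exact arrow α
  | mul x y hx hy => rw [map_mul]; exact mul _ _ hx hy
  | add x y hx hy => rw [map_add]; exact add _ _ hx hy

theorem GPA.arrow_mul_inc {i j : V} (α : i ⟶ j) :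
    GPA.arrow k A α * GPA.base k A (inc j 1) = GPA.arrow k A α := by
  conv_lhs => rw [← GPA.base_mul_arrow k A α]
  rw [mul_assoc, ← map_mul, ← inc_mul, one_mul, GPA.base_mul_arrow]

theorem GPA.inc_mul_arrow {i j : V} (α : i ⟶ j) :
    GPA.base k A (inc i 1) * GPA.arrow k A α = GPA.arrow k A α := by
  conv_lhs => rw [← GPA.base_mul_arrow k A α]
  rw [← mul_assoc, ← mul_assoc, ← map_mul, ← inc_mul, one_mul, GPA.base_mul_arrow]

section Lift

variable {B : Type*} [Ring B] [Algebra k B] (ρ : (∀ l, A l) →ₐ[k] B)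
  (g : ∀ ⦃i j : V⦄, (i ⟶ j) → B)
  (hg : ∀ ⦃i j : V⦄ (α : i ⟶ j), ρ (inc i 1) * g α * ρ (inc j 1) = g α)

/-- The universal property of the generalized path algebra, as a tensor algebra: an algebra
homomorphism out of it is given by its values on `∏ A_l` and on the arrows. -/
noncomputable def GPA.lift : GPA k A →ₐ[k] B :=
  RingQuot.liftAlgHom k ⟨FreeAlgebra.lift k (Sum.elim ρ fun α => g α.2.2), fun x y h => by
    cases h with
    | add a b => simp
    | mul a b => simp
    | scalar c => simp
    | arrow α => simpa using hg α⟩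

@[simp]
theorem GPA.lift_base (a : ∀ l, A l) : GPA.lift ρ g hg (GPA.base k A a) = ρ a :=
  (RingQuot.liftAlgHom_mkAlgHom_apply k _ _ _).trans (by simp)

@[simp]
theorem GPA.lift_arrow {i j : V} (α : i ⟶ j) : GPA.lift ρ g hg (GPA.arrow k A α) = g α :=
  (RingQuot.liftAlgHom_mkAlgHom_apply k _ _ _).trans (by simp)

end Lift

end GeneralizedPathAlgebra

section PathAlgebra

variable {k : Type*} [Field k] {Q : Type*} [Quiver Q]

theorem pathElem_mul_base {i j : Q} (p : Quiver.Path i j) (a : Q → k) :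
    pathElem k p * GPA.base k (fun _ : Q => k) a = a j • pathElem k p := by
  have inc_mul_base : GPA.base k (fun _ : Q => k) (inc j 1) * GPA.base k (fun _ : Q => k) a =
      a j • GPA.base k (fun _ : Q => k) (inc j 1) := by
    rw [← map_mul, inc_mul_pi, one_mul, ← map_smul, ← inc_smul, smul_eq_mul, mul_one]
  cases p with
  | nil => rwa [pathElem]
  | cons p α =>
    rw [pathElem, ← GPA.arrow_mul_inc, mul_assoc, mul_assoc, inc_mul_base, mul_smul_comm,
      mul_smul_comm]

theorem pathElem_mul_arrow_of_ne {i j l m : Q} (h : j ≠ l) (p : Quiver.Path i j) (α : l ⟶ m) :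
    pathElem k p * GPA.arrow k (fun _ : Q => k) α = 0 := by
  rw [← GPA.inc_mul_arrow, ← mul_assoc, pathElem_mul_base, inc_of_ne h, zero_smul, zero_mul]

theorem mul_mem_arrowIdealPow {m : ℕ} {y : PathAlgebra k Q} (hy : y ∈ arrowIdealPow k Q m)
    (x : PathAlgebra k Q) : y * x ∈ arrowIdealPow k Q m := by
  have of_path (x : PathAlgebra k Q) (hx : ∀ ⦃i j : Q⦄ (p : Quiver.Path i j), m ≤ p.length →
      pathElem k p * x ∈ arrowIdealPow k Q m) :
      ∀ y ∈ arrowIdealPow k Q m, y * x ∈ arrowIdealPow k Q m := by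
    refine Submodule.span_le (p := (arrowIdealPow k Q m).comap (LinearMap.mulRight k x)).2 ?_
    rintro _ ⟨i, j, p, hp, rfl⟩
    exact hx p hp
  induction x using GPA.induction generalizing y with
  | base a =>
    refine of_path _ (fun i j p hp => ?_) y hy
    rw [pathElem_mul_base]
    exact Submodule.smul_mem _ _ (Submodule.subset_span ⟨i, j, p, hp, rfl⟩)
  | @arrow l l' α =>
    refine of_path _ (fun i j p hp => ?_) y hy
    by_cases h : j = l
    · subst h
      exact Submodule.subset_span ⟨i, l', p.cons α, hp.trans (Nat.le_succ _), by rw [pathElem]⟩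
    · rw [pathElem_mul_arrow_of_ne h]
      exact Submodule.zero_mem _
  | mul x x' hx hx' => exact mul_assoc y x x' ▸ hx' (hx hy)
  | add x x' hx hx' => exact mul_add y x x' ▸ Submodule.add_mem _ (hx hy) (hx' hy)

variable (k Q) in
theorem arrowIdealPow_zero [Finite Q] : arrowIdealPow k Q 0 = ⊤ := by
  have := Fintype.ofFinite Q
  have one_mem : (1 : PathAlgebra k Q) ∈ arrowIdealPow k Q 0 := by
    rw [← map_one (GPA.base k fun _ : Q => k), ← sum_inc (1 : Q → k), map_sum]
    exact Submodule.sum_mem _ fun l _ =>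
      Submodule.subset_span ⟨l, l, .nil, Nat.zero_le _, by rw [pathElem, Pi.one_apply]⟩
  exact eq_top_iff.2 fun x _ => one_mul x ▸ mul_mem_arrowIdealPow one_mem x

theorem BoundPresentation.span_proj {A : Type*} [Ring A] [Algebra k A]
    (P : BoundPresentation k A) :
    Submodule.span k {x : A | ∃ (a b : P.vertices) (γ : Quiver.Path a b),
      x = P.proj (pathElem k γ)} = ⊤ := by
  have := P.finite_vertices
  rw [eq_top_iff, ← (LinearMap.range_eq_top (f := P.proj.toLinearMap)).2 P.surjective,
    LinearMap.range_eq_map, ← arrowIdealPow_zero k P.vertices, arrowIdealPow, Submodule.map_span]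
  refine Submodule.span_mono ?_
  rintro _ ⟨_, ⟨a, b, γ, -, rfl⟩, rfl⟩
  exact ⟨a, b, γ, rfl⟩

end PathAlgebra

section Bound

variable {k : Type*} [Field k] {V : Type*} [Quiver V] {A : V → Type*}
  [∀ i, Ring (A i)] [∀ i, Algebra k (A i)]
  (P : ∀ i, BoundPresentation k (A i)) (I : Set (Relation k V))

section BoundGPA

variable {P I} in
theorem IsInterleaving.exists_eq_mul_arrow {i j : V} {p : Quiver.Path i j} {z : GPA k A}
    (h : IsInterleaving P p z) :
    ∃ (l : V) (β : l ⟶ j) (y : GPA k A), z = y * GPA.arrow k A β := by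
  cases h with
  | single β => exact ⟨_, β, 1, (one_mul _).symm⟩
  | cons p z β γ _ => exact ⟨_, β, _, rfl⟩

variable {P I} in
theorem map_eq_zero_of_mem_boundSet {W : Type*} [AddCommGroup W] [Module k W]
    (f : GPA k A →ₗ[k] W)
    (hf : ∀ ρ ∈ I, ∀ p ∈ ρ.coeff.support, ∀ z, IsInterleaving P p z → f z = 0) {z : GPA k A}
    (hz : z ∈ boundSet P I) : f z = 0 := by
  obtain ⟨ρ, hρ, y, hy, rfl⟩ := hz
  rw [map_finsuppSum]
  exact Finset.sum_eq_zero fun p hp =>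
    (map_smul f _ _).trans (by rw [hf ρ hρ p hp _ (hy p hp), smul_zero])

theorem BoundGPA.mk_surjective : Function.Surjective (BoundGPA.mk P I) :=
  RingQuot.mkAlgHom_surjective k _

theorem BoundGPA.mk_eq_zero {z : GPA k A} (hz : z ∈ boundSet P I) : BoundGPA.mk P I z = 0 := by
  rw [← map_zero (BoundGPA.mk P I)]
  exact RingQuot.mkAlgHom_rel k (s := fun y z : GPA k A => y ∈ boundSet P I ∧ z = 0) ⟨hz, rfl⟩

variable {P I} in
@[elab_as_elim]
theorem BoundGPA.induction {C : BoundGPA P I → Prop} (base : ∀ a, C (BoundGPA.base P I a))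
    (arrow : ∀ {i j : V} (α : i ⟶ j), C (BoundGPA.arrow P I α))
    (mul : ∀ x y, C x → C y → C (x * y)) (add : ∀ x y, C x → C y → C (x + y))
    (x : BoundGPA P I) : C x := by
  obtain ⟨z, rfl⟩ := BoundGPA.mk_surjective P I x
  induction z using GPA.induction with
  | base a => exact base a
  | arrow α => exact arrow α
  | mul x y hx hy => exact (map_mul (BoundGPA.mk P I) x y).symm ▸ mul _ _ hx hy
  | add x y hx hy => exact (map_add (BoundGPA.mk P I) x y).symm ▸ add _ _ hx hy

section Lift

variable {B : Type*} [Ring B] [Algebra k B] (Ψ : GPA k A →ₐ[k] B)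
  (hΨ : ∀ z ∈ boundSet P I, Ψ z = 0)

/-- The universal property of `Λ` as a quotient of `k(Γ, 𝒜)`. -/
noncomputable def BoundGPA.lift : BoundGPA P I →ₐ[k] B :=
  RingQuot.liftAlgHom k ⟨Ψ, fun _ _ h => by rw [h.2, map_zero, hΨ _ h.1]⟩

theorem BoundGPA.lift_mk (z : GPA k A) :
    BoundGPA.lift P I Ψ hΨ (BoundGPA.mk P I z) = Ψ z :=
  RingQuot.liftAlgHom_mkAlgHom_apply k _ _ z

end Lift

/-- The retraction of `Λ` onto `∏ A_l` that annihilates the arrows. -/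
noncomputable def BoundGPA.augmentation : BoundGPA P I →ₐ[k] ∀ l, A l :=
  BoundGPA.lift P I (GPA.lift (AlgHom.id k (∀ l, A l)) (fun _ _ _ => 0) (by simp)) fun _ hz =>
    map_eq_zero_of_mem_boundSet
      (GPA.lift (AlgHom.id k (∀ l, A l)) (fun _ _ _ => 0) (by simp)).toLinearMap
      (fun _ _ _ _ _ h => by
        obtain ⟨l, β, y, rfl⟩ := h.exists_eq_mul_arrow
        simp) hz

theorem BoundGPA.augmentation_base (a : ∀ l, A l) :
    BoundGPA.augmentation P I (BoundGPA.base P I a) = a :=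
  (BoundGPA.lift_mk P I _ _ (GPA.base k A a)).trans (GPA.lift_base _ _ _ a)

theorem BoundGPA.augmentation_arrow {i j : V} (α : i ⟶ j) :
    BoundGPA.augmentation P I (BoundGPA.arrow P I α) = 0 :=
  (BoundGPA.lift_mk P I _ _ (GPA.arrow k A α)).trans (GPA.lift_arrow _ _ _ α)

theorem BoundGPA.base_mul_elem (i : V) (x : ∀ l, A l) (a : A i) :
    BoundGPA.base P I x * BoundGPA.elem P I i a = BoundGPA.elem P I i (x i * a) := by
  rw [elem, ← map_mul, pi_mul_inc, elem]

theorem BoundGPA.elem_mul_elem_of_ne {i j : V} (h : i ≠ j) (a : A i) (b : A j) :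
    BoundGPA.elem P I i a * BoundGPA.elem P I j b = 0 := by
  rw [elem, elem, ← map_mul, inc_mul_inc_of_ne h, map_zero]

theorem BoundGPA.elem_one_mul_arrow {i j : V} (α : i ⟶ j) :
    BoundGPA.elem P I i 1 * BoundGPA.arrow P I α = BoundGPA.arrow P I α :=
  (map_mul (BoundGPA.mk P I) _ _).symm.trans (congrArg _ (GPA.inc_mul_arrow α))

theorem BoundGPA.arrow_mul_elem_of_ne {i j l : V} (h : j ≠ l) (α : i ⟶ j) (a : A l) :
    BoundGPA.arrow P I α * BoundGPA.elem P I l a = 0 := by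
  rw [← arrow_mul_elem, mul_assoc, elem_mul_elem_of_ne P I h, mul_zero]

/-- The inclusion of `A_i` in `Λ` as a linear map. -/
noncomputable def BoundGPA.elemLinear (i : V) : A i →ₗ[k] BoundGPA P I where
  toFun := BoundGPA.elem P I i
  map_add' := BoundGPA.elem_add P I i
  map_smul' c a := by rw [elem, inc_smul, map_smul]; rfl

end BoundGPA

section Representation

variable {N : Type*} [AddCommGroup N] [Module k N] [Module (BoundGPA P I)ᵐᵒᵖ N]
  [IsScalarTower k (BoundGPA P I)ᵐᵒᵖ N]

theorem VertexModule.val_injective (j : V) : Function.Injective (VertexModule.val P I (N := N) j) :=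
  Subtype.val_injective

theorem VertexModule.val_smul (j : V) (a : (A j)ᵐᵒᵖ) (y : VertexModule P I N j) :
    VertexModule.val P I j (a • y) =
      op (BoundGPA.elem P I j a.unop) • VertexModule.val P I j y := rfl

theorem VertexModule.val_arrowMap {i j : V} (α : i ⟶ j) (y : VertexModule P I N i) :
    VertexModule.val P I j (arrowMap P I α y) =
      op (BoundGPA.arrow P I α) • VertexModule.val P I i y := rfl

instance (j : V) : IsScalarTower k (A j)ᵐᵒᵖ (VertexModule P I N j) :=
  .of_algebraMap_smul fun c y => by
    apply VertexModule.val_injective P I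
    have elem_algebraMap : BoundGPA.elem P I j (algebraMap k (A j) c) =
        c • BoundGPA.elem P I j 1 := by
      rw [Algebra.algebraMap_eq_smul_one]
      exact map_smul (BoundGPA.elemLinear P I j) c 1
    rw [VertexModule.val_smul, map_smul, MulOpposite.algebraMap_apply, unop_op, elem_algebraMap,
      op_smul, smul_assoc]
    exact congrArg (c • ·) (elem_one_smul P I j y)

variable (N) in
/-- The projection `x ↦ x · 1_j` of a right `Λ`-module onto its component at `j`. -/
noncomputable def vertexProj (j : V) : N →ₗ[k] VertexModule P I N j :=
  LinearMap.codRestrict (vertexSpace P I N j)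
    (Algebra.lsmul k k N (op (BoundGPA.elem P I j 1))) fun x => ⟨x, rfl⟩

theorem val_vertexProj (j : V) (x : N) :
    VertexModule.val P I j (vertexProj P I N j x) = op (BoundGPA.elem P I j 1) • x := rfl

theorem vertexProj_val (j : V) (y : VertexModule P I N j) :
    vertexProj P I N j (VertexModule.val P I j y) = y :=
  VertexModule.val_injective P I j (elem_one_smul P I j y)

theorem vertexProj_base_smul (j : V) (a : ∀ l, A l) (x : N) :
    vertexProj P I N j (op (BoundGPA.base P I a) • x) = op (a j) • vertexProj P I N j x := by
  apply VertexModule.val_injective P I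
  rw [VertexModule.val_smul, val_vertexProj, val_vertexProj, ← mul_smul, ← op_mul, ← mul_smul,
    ← op_mul, unop_op, ← BoundGPA.elem_mul, one_mul, BoundGPA.base_mul_elem, mul_one]

theorem vertexProj_arrow_smul {j j' : V} (α : j ⟶ j') (x : N) :
    vertexProj P I N j' (op (BoundGPA.arrow P I α) • x) =
      arrowMap P I α (vertexProj P I N j x) := by
  apply VertexModule.val_injective P I
  rw [VertexModule.val_arrowMap, val_vertexProj, val_vertexProj, ← mul_smul, ← op_mul, ← mul_smul,
    ← op_mul, BoundGPA.arrow_mul_elem, BoundGPA.elem_one_mul_arrow]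

theorem vertexProj_arrow_smul_of_ne {j j' l : V} (h : j' ≠ l) (α : j ⟶ j') (x : N) :
    vertexProj P I N l (op (BoundGPA.arrow P I α) • x) = 0 := by
  apply VertexModule.val_injective P I
  rw [val_vertexProj, ← mul_smul, ← op_mul, BoundGPA.arrow_mul_elem_of_ne P I h, op_zero,
    zero_smul, map_zero]

end Representation

end Bound

/-- The action of an algebra `R` on a right `R`-module `N`, as an algebra homomorphism. -/
noncomputable def rightAction (k R N : Type*) [CommSemiring k] [Semiring R] [Algebra k R]
    [AddCommMonoid N] [Module k N] [Module Rᵐᵒᵖ N] [IsScalarTower k Rᵐᵒᵖ N] :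
    R →ₐ[k] (Module.End k N)ᵐᵒᵖ :=
  AlgHom.opComm.symm (Algebra.lsmul k k N)

section Cone

variable {k : Type*} [Field k] {V : Type*} [Quiver V] {A : V → Type*}
  [∀ i, Ring (A i)] [∀ i, Algebra k (A i)]
  (P : ∀ i, BoundPresentation k (A i)) (I : Set (Relation k V))
  (i : V) {M : Type*} [AddCommGroup M] [Module k M] [Module (A i)ᵐᵒᵖ M]

variable (M) in
/-- The map `(m, l) ↦ m ⊗ l` as a bilinear map. -/
noncomputable def Cone.tmulHom : M →ₗ[k] BoundGPA P I →ₗ[k] Cone P I i M :=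
  LinearMap.mk₂ k (Cone.tmul P I i)
    (fun m n l => congrArg (Submodule.Quotient.mk (p := coneRelations P I i M)) (tmul_add l m n))
    (fun c m l => congrArg (Submodule.Quotient.mk (p := coneRelations P I i M)) (tmul_smul c l m))
    (fun m l l' => congrArg (Submodule.Quotient.mk (p := coneRelations P I i M)) (add_tmul l l' m))
    (fun c m l => congrArg (Submodule.Quotient.mk (p := coneRelations P I i M))
      (smul_tmul' c l m).symm)

theorem Cone.op_smul_tmul (m : M) (l l' : BoundGPA P I) :
    op l' • Cone.tmul P I i m l = Cone.tmul P I i m (l * l') := rfl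

theorem Cone.tmul_base_mul (m : M) (a : ∀ l, A l) (l : BoundGPA P I) :
    Cone.tmul P I i m (BoundGPA.base P I a * l) = Cone.tmul P I i (op (a i) • m) l :=
  ((Submodule.Quotient.eq (coneRelations P I i M)).2
    (Submodule.subset_span ⟨m, a, l, rfl⟩)).symm

theorem Cone.base_smul_tmul_one (m : M) (a : ∀ l, A l) :
    op (BoundGPA.base P I a) • Cone.tmul P I i m 1 = Cone.tmul P I i (op (a i) • m) 1 := by
  rw [op_smul_tmul, one_mul, ← tmul_base_mul, mul_one]

variable {P I i} in
@[elab_as_elim]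
theorem Cone.induction {C : Cone P I i M → Prop} (tmul_one : ∀ m, C (Cone.tmul P I i m 1))
    (add : ∀ x y, C x → C y → C (x + y))
    (base_smul : ∀ a x, C x → C (op (BoundGPA.base P I a) • x))
    (arrow_smul : ∀ {j j' : V} (α : j ⟶ j') (x), C x → C (op (BoundGPA.arrow P I α) • x))
    (x : Cone P I i M) : C x := by
  have op_smul (l : BoundGPA P I) : ∀ x, C x → C (op l • x) := by
    induction l using BoundGPA.induction with
    | base a => exact base_smul a
    | arrow α => exact arrow_smul α
    | mul l l' hl hl' => exact fun x hx => mul_smul (op l') (op l) x ▸ hl' _ (hl _ hx)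
    | add l l' hl hl' => exact fun x hx => add_smul (op l) (op l') x ▸ add _ _ (hl _ hx) (hl' _ hx)
  obtain ⟨t, rfl⟩ := Submodule.Quotient.mk_surjective (coneRelations P I i M) x
  induction t with
  | zero =>
    have h := op_smul 0 _ (tmul_one 0)
    rwa [op_zero, zero_smul] at h
  | tmul l m =>
    have h := op_smul l _ (tmul_one m)
    rwa [Cone.op_smul_tmul, one_mul] at h
  | add x y hx hy => exact add _ _ hx hy

section Lift

variable {N : Type*} [AddCommGroup N] [Module k N]
  (Φ : BoundGPA P I →ₐ[k] (Module.End k N)ᵐᵒᵖ) (ι : M →ₗ[k] N)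

/-- The linear map `l ⊗ m ↦ ι(m) · l`, for the right action `Φ` of `Λ` on `N`. -/
noncomputable def actionTensor : BoundGPA P I ⊗[k] M →ₗ[k] N :=
  TensorProduct.lift
    (LinearMap.mk₂ k (fun l m => (Φ l).unop (ι m)) (by simp) (by simp) (by simp) (by simp))

theorem actionTensor_op_smul (l : BoundGPA P I) (t : BoundGPA P I ⊗[k] M) :
    actionTensor P I Φ ι (op l • t) = (Φ l).unop (actionTensor P I Φ ι t) := by
  induction t with
  | zero => simp
  | tmul l' m =>
    rw [TensorProduct.smul_tmul', op_smul_eq_mul]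
    exact congrArg (fun f => f.unop (ι m)) (map_mul Φ l' l)
  | add x y hx hy => rw [smul_add, map_add, map_add, map_add, hx, hy]

variable (h : ∀ m a, (Φ (BoundGPA.base P I a)).unop (ι m) = ι (op (a i) • m))

include h in
theorem coneRelations_le_ker_actionTensor :
    (coneRelations P I i M).restrictScalars k ≤ LinearMap.ker (actionTensor P I Φ ι) := by
  intro t ht
  induction ht using Submodule.span_induction with
  | mem t ht =>
    obtain ⟨m, a, l, rfl⟩ := ht
    rw [LinearMap.mem_ker, map_sub, sub_eq_zero]
    change (Φ l).unop (ι (op (a i) • m)) = (Φ (BoundGPA.base P I a * l)).unop (ι m)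
    rw [← h, map_mul]
    rfl
  | zero => exact Submodule.zero_mem _
  | add x y _ _ hx hy => exact Submodule.add_mem _ hx hy
  | smul l x _ hx =>
    rw [LinearMap.mem_ker, ← op_unop l, actionTensor_op_smul, LinearMap.mem_ker.1 hx, map_zero]

/-- The universal property of the cone: an `A_i`-linear map `ι` from `M` to the right `Λ`-module `N`
with action `Φ` extends to the cone. -/
noncomputable def Cone.lift : Cone P I i M →ₗ[k] N :=
  Submodule.liftQ _ (actionTensor P I Φ ι) (coneRelations_le_ker_actionTensor P I i Φ ι h) ∘ₗ
    (Submodule.Quotient.restrictScalarsEquiv k (coneRelations P I i M)).symm.toLinearMap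

theorem Cone.lift_tmul_one (m : M) : Cone.lift P I i Φ ι h (Cone.tmul P I i m 1) = ι m :=
  congrArg (fun f => f.unop (ι m)) (map_one Φ)

theorem Cone.lift_op_smul (l : BoundGPA P I) (x : Cone P I i M) :
    Cone.lift P I i Φ ι h (op l • x) = (Φ l).unop (Cone.lift P I i Φ ι h x) := by
  obtain ⟨t, rfl⟩ := Submodule.Quotient.mk_surjective (coneRelations P I i M) x
  exact actionTensor_op_smul P I Φ ι l t

end Lift

section Retraction

variable [IsScalarTower k (A i)ᵐᵒᵖ M]

variable (M) in
/-- The retraction of the cone onto `M` that annihilates the multiples of the arrows. -/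
noncomputable def Cone.retraction : Cone P I i M →ₗ[k] M :=
  Cone.lift P I i (((rightAction k (A i) M).comp (Pi.evalAlgHom k A i)).comp
    (BoundGPA.augmentation P I)) LinearMap.id
    fun m a => congrArg (fun x => op (x i) • m) (BoundGPA.augmentation_base P I a)

theorem Cone.retraction_tmul_one (m : M) :
    Cone.retraction P I i M (Cone.tmul P I i m 1) = m :=
  Cone.lift_tmul_one P I i _ _ _ m

theorem Cone.retraction_op_smul (l : BoundGPA P I) (x : Cone P I i M) :
    Cone.retraction P I i M (op l • x) =
      op (BoundGPA.augmentation P I l i) • Cone.retraction P I i M x :=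
  Cone.lift_op_smul P I i _ _ _ l x

theorem Cone.retraction_elem_one_smul (x : Cone P I i M) :
    Cone.retraction P I i M (op (BoundGPA.elem P I i 1) • x) = Cone.retraction P I i M x := by
  rw [retraction_op_smul, BoundGPA.elem, BoundGPA.augmentation_base, inc_same, op_one, one_smul]

theorem Cone.retraction_arrow_smul {j j' : V} (α : j ⟶ j') (x : Cone P I i M) :
    Cone.retraction P I i M (op (BoundGPA.arrow P I α) • x) = 0 := by
  rw [retraction_op_smul, BoundGPA.augmentation_arrow, Pi.zero_apply, op_zero, zero_smul]

end Retraction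

end Cone

section Fox

variable {k : Type*} [Field k] {V : Type*} [Quiver V] {A : V → Type*}
  [∀ i, Ring (A i)] [∀ i, Algebra k (A i)]
  (P : ∀ i, BoundPresentation k (A i)) (I : Set (Relation k V))

section Action

variable {N : Type*} [AddCommGroup N] [Module k N] [Module (BoundGPA P I)ᵐᵒᵖ N]
  [IsScalarTower k (BoundGPA P I)ᵐᵒᵖ N]
  (c : ∀ ⦃j j' : V⦄, (j ⟶ j') → (N →ₗ[k] k))

/-- A family of functionals on `N`, one for each arrow, is supported at the sources if the
functional of an arrow that starts at `j` factors through `N · 1_j`. -/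
def IsSourceSupported : Prop :=
  ∀ ⦃j j' : V⦄ (α : j ⟶ j') (x : N), c α (op (BoundGPA.elem P I j 1) • x) = c α x

/-- The right action of `k(Γ, 𝒜)` on `N × ∏ A_l` for which `a` in `∏ A_l` sends `(x, r)` to
`(x · a, r a)` and an arrow `α` that ends at `j` sends `(x, r)` to `(x · α, c_α(x) 1_j)`. It makes
`N × ∏ A_l` an extension of `N` by `∏ A_l`, on which the arrows act by zero. -/
noncomputable def foxAction (hc : IsSourceSupported P I c) :
    GPA k A →ₐ[k] (Module.End k (N × ∀ l, A l))ᵐᵒᵖ :=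
  GPA.lift
    (AlgHom.opComm.symm ((LinearMap.prodMapAlgHom k N (∀ l, A l)).comp
      (((Algebra.lsmul k k N).comp (AlgHom.op (BoundGPA.base P I))).prod
        (Algebra.lsmul k k (∀ l, A l)))))
    (fun _ j' α => op (((Algebra.lsmul k k N (op (BoundGPA.arrow P I α))).prod
      ((c α).smulRight (inc j' 1))) ∘ₗ LinearMap.fst k N (∀ l, A l)))
    fun j j' α => by
      refine unop_injective (LinearMap.ext fun n => Prod.ext ?_ ?_)
      · change op (BoundGPA.elem P I j' 1) • op (BoundGPA.arrow P I α) •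
          op (BoundGPA.elem P I j 1) • n.1 = op (BoundGPA.arrow P I α) • n.1
        rw [← mul_smul, ← op_mul, ← mul_smul, ← op_mul, BoundGPA.arrow_mul_elem,
          BoundGPA.elem_one_mul_arrow]
      · change (c α (op (BoundGPA.elem P I j 1) • n.1) • inc j' (1 : A j')) * inc j' 1 =
          c α n.1 • inc j' 1
        rw [hc, smul_mul_assoc, ← inc_mul, one_mul]

variable (hc : IsSourceSupported P I c)

theorem foxAction_base (a : ∀ l, A l) (n : N × ∀ l, A l) :
    (foxAction P I c hc (GPA.base k A a)).unop n = (op (BoundGPA.base P I a) • n.1, n.2 * a) :=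
  congrArg (fun f : (Module.End k (N × ∀ l, A l))ᵐᵒᵖ => f.unop n) (GPA.lift_base _ _ _ a)

theorem foxAction_arrow {j j' : V} (α : j ⟶ j') (n : N × ∀ l, A l) :
    (foxAction P I c hc (GPA.arrow k A α)).unop n =
      (op (BoundGPA.arrow P I α) • n.1, c α n.1 • inc j' 1) :=
  congrArg (fun f : (Module.End k (N × ∀ l, A l))ᵐᵒᵖ => f.unop n) (GPA.lift_arrow _ _ _ α)

theorem foxAction_mul (y z : GPA k A) (n : N × ∀ l, A l) :
    (foxAction P I c hc (y * z)).unop n =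
      (foxAction P I c hc z).unop ((foxAction P I c hc y).unop n) := by
  rw [map_mul]
  rfl

theorem foxAction_fst (z : GPA k A) (n : N × ∀ l, A l) :
    ((foxAction P I c hc z).unop n).1 = op (BoundGPA.mk P I z) • n.1 := by
  induction z using GPA.induction generalizing n with
  | base a => rw [foxAction_base]; rfl
  | arrow α => rw [foxAction_arrow]; rfl
  | mul y z hy hz => rw [foxAction_mul, hz, hy, ← mul_smul, ← op_mul, ← map_mul]
  | add y z hy hz => rw [map_add, unop_add, LinearMap.add_apply, Prod.fst_add, hy, hz, ← add_smul,
      ← op_add, ← map_add]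

/-- The component in `∏ A_l` of `n · z`, as a linear function of `z`. -/
noncomputable def foxCoord (n : N × ∀ l, A l) : GPA k A →ₗ[k] ∀ l, A l where
  toFun z := ((foxAction P I c hc z).unop n).2
  map_add' y z := by rw [map_add, unop_add, LinearMap.add_apply, Prod.snd_add]
  map_smul' a z := by
    rw [map_smul, unop_smul, LinearMap.smul_apply, Prod.smul_snd, RingHom.id_apply]

theorem foxCoord_mul_arrow {j j' : V} (n : N × ∀ l, A l) (y : GPA k A) (α : j ⟶ j') :
    foxCoord P I c hc n (y * GPA.arrow k A α) =
      c α (op (BoundGPA.mk P I y) • n.1) • inc j' 1 := by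
  change ((foxAction P I c hc (y * GPA.arrow k A α)).unop n).2 = _
  rw [foxAction_mul, foxAction_arrow, foxAction_fst]

theorem foxAction_eq_zero {z : GPA k A} (hz : z ∈ boundSet P I)
    (h : ∀ n, foxCoord P I c hc n z = 0) : foxAction P I c hc z = 0 := by
  refine unop_injective (LinearMap.ext fun n => Prod.ext ?_ (h n))
  rw [foxAction_fst, BoundGPA.mk_eq_zero P I hz, op_zero, zero_smul]
  rfl

end Action

section Derivation

variable (i : V) {M : Type*} [AddCommGroup M] [Module k M] [Module (A i)ᵐᵒᵖ M]

variable {P I i} in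
/-- `Θ` is the right Fox derivation on the cone with arrow functionals `c`: it vanishes on `M`, it
is linear over `∏ A_l`, and `Θ(x · α) = c_α(x) 1_j` for an arrow `α` that ends at `j`. -/
structure IsFoxDerivation (c : ∀ ⦃j j' : V⦄, (j ⟶ j') → (Cone P I i M →ₗ[k] k))
    (Θ : Cone P I i M →ₗ[k] ∀ l, A l) : Prop where
  tmul_one (m : M) : Θ (Cone.tmul P I i m 1) = 0
  base_smul (a : ∀ l, A l) (x : Cone P I i M) : Θ (op (BoundGPA.base P I a) • x) = Θ x * a
  arrow_smul {j j' : V} (α : j ⟶ j') (x : Cone P I i M) :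
    Θ (op (BoundGPA.arrow P I α) • x) = c α x • inc j' 1

theorem exists_isFoxDerivation (c : ∀ ⦃j j' : V⦄, (j ⟶ j') → (Cone P I i M →ₗ[k] k))
    (hc : IsSourceSupported P I c)
    (hI : ∀ z ∈ boundSet P I, ∀ n, foxCoord P I c hc n z = 0) :
    ∃ Θ : Cone P I i M →ₗ[k] ∀ l, A l, IsFoxDerivation c Θ := by
  let Φ := BoundGPA.lift P I (foxAction P I c hc) fun z hz =>
    foxAction_eq_zero P I c hc hz (hI z hz)
  have Φ_mk (z : GPA k A) (n) :
      (Φ (BoundGPA.mk P I z)).unop n = (foxAction P I c hc z).unop n := by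
    rw [BoundGPA.lift_mk]
  let θ : Cone P I i M →ₗ[k] Cone P I i M × ∀ l, A l :=
    Cone.lift P I i Φ (LinearMap.inl k _ _ ∘ₗ (Cone.tmulHom P I i M).flip 1) fun m a => by
      refine (Φ_mk _ _).trans ((foxAction_base P I c hc a _).trans ?_)
      exact Prod.ext (Cone.base_smul_tmul_one P I i m a) (zero_mul a)
  have θ_tmul_one (m : M) : θ (Cone.tmul P I i m 1) = (Cone.tmul P I i m 1, 0) :=
    Cone.lift_tmul_one P I i _ _ _ m
  have θ_smul (z : GPA k A) (x : Cone P I i M) :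
      θ (op (BoundGPA.mk P I z) • x) = (foxAction P I c hc z).unop (θ x) := by
    rw [← Φ_mk]
    exact Cone.lift_op_smul P I i _ _ _ _ x
  have fst_θ (x : Cone P I i M) : (θ x).1 = x := by
    induction x using Cone.induction with
    | tmul_one m => rw [θ_tmul_one]
    | add x y hx hy => rw [map_add, Prod.fst_add, hx, hy]
    | base_smul a x hx => exact (congrArg Prod.fst (θ_smul (GPA.base k A a) x)).trans (by
        rw [foxAction_base, hx])
    | arrow_smul α x hx => exact (congrArg Prod.fst (θ_smul (GPA.arrow k A α) x)).trans (by
        rw [foxAction_arrow, hx])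
  refine ⟨LinearMap.snd k _ _ ∘ₗ θ, fun m => congrArg Prod.snd (θ_tmul_one m), fun a x => ?_,
    fun {j j'} α x => ?_⟩
  · exact (congrArg Prod.snd (θ_smul (GPA.base k A a) x)).trans (by rw [foxAction_base]; rfl)
  · exact (congrArg Prod.snd (θ_smul (GPA.arrow k A α) x)).trans (by rw [foxAction_arrow, fst_θ])

end Derivation

end Fox

section Dual

variable {k : Type*} [Field k] {V : Type*} [Quiver V] {A : V → Type*}
  [∀ i, Ring (A i)] [∀ i, Algebra k (A i)]
  (P : ∀ i, BoundPresentation k (A i)) (I : Set (Relation k V)) {i : V}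
  {M : Type*} [AddCommGroup M] [Module k M] [Module (A i)ᵐᵒᵖ M]
  {κ : V → Type*} (b : ∀ l, Module.Basis (κ l) k (A l)) {τ : Type*} (μ : Module.Basis τ k M)

/-- The functionals `x ↦ f(x · α)` on a right `Λ`-module, one for each arrow `α`. -/
noncomputable def arrowFunctional {N : Type*} [AddCommGroup N] [Module k N]
    [Module (BoundGPA P I)ᵐᵒᵖ N] [IsScalarTower k (BoundGPA P I)ᵐᵒᵖ N] (f : N →ₗ[k] k)
    ⦃j j' : V⦄ (α : j ⟶ j') : N →ₗ[k] k :=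
  f ∘ₗ Algebra.lsmul k k N (op (BoundGPA.arrow P I α))

theorem isSourceSupported_arrowFunctional {N : Type*} [AddCommGroup N] [Module k N]
    [Module (BoundGPA P I)ᵐᵒᵖ N] [IsScalarTower k (BoundGPA P I)ᵐᵒᵖ N] (f : N →ₗ[k] k) :
    IsSourceSupported P I (arrowFunctional P I f) := fun j j' α x => by
  change f (op (BoundGPA.arrow P I α) • op (BoundGPA.elem P I j 1) • x) =
    f (op (BoundGPA.arrow P I α) • x)
  rw [← mul_smul, ← op_mul, BoundGPA.elem_one_mul_arrow]

-- All the paths of a relation end at one vertex `j`, so that on the relation the Fox coordinate is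
-- `f` of its value in `Λ`, which is zero, times `1_j`.
theorem exists_isFoxDerivation_arrowFunctional (f : Cone P I i M →ₗ[k] k) :
    ∃ Θ : Cone P I i M →ₗ[k] ∀ l, A l, IsFoxDerivation (arrowFunctional P I f) Θ := by
  refine exists_isFoxDerivation P I i _ (isSourceSupported_arrowFunctional P I f) ?_
  rintro z hz n
  have mk_z := BoundGPA.mk_eq_zero P I hz
  obtain ⟨ρ, -, y, hy, rfl⟩ := hz
  let g : GPA k A →ₗ[k] ∀ l, A l := (f.smulRight (inc ρ.tgt 1)) ∘ₗ
    (LinearMap.toSpanSingleton (BoundGPA P I)ᵐᵒᵖ _ n.1).restrictScalars k ∘ₗ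
    (opLinearEquiv k).toLinearMap ∘ₗ (BoundGPA.mk P I).toLinearMap
  have g_apply (z : GPA k A) : g z = f (op (BoundGPA.mk P I z) • n.1) • inc ρ.tgt 1 := rfl
  have foxCoord_eq (p) (hp : p ∈ ρ.coeff.support) :
      foxCoord P I _ (isSourceSupported_arrowFunctional P I f) n (y p) = g (y p) := by
    obtain ⟨l, β, u, hu⟩ := (hy p hp).exists_eq_mul_arrow
    rw [hu, foxCoord_mul_arrow, g_apply, map_mul, op_mul, mul_smul]
    rfl
  calc foxCoord P I _ (isSourceSupported_arrowFunctional P I f) n (ρ.coeff.sum fun p c => c • y p)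
      = g (ρ.coeff.sum fun p c => c • y p) := by
        rw [map_finsuppSum, map_finsuppSum]
        exact Finsupp.sum_congr fun p hp => by rw [map_smul, map_smul, foxCoord_eq p hp]
    _ = 0 := by rw [g_apply, mk_z, op_zero, zero_smul, map_zero, zero_smul]

theorem val_seqClass {j : V} (s : τ × Word κ i j) :
    VertexModule.val P I j (seqClass P I b μ s) = Cone.tmul P I i (μ s.1) (s.2.elem P I b) := rfl

theorem val_seqClass_single {j : V} (p : τ) (α : i ⟶ j) :
    VertexModule.val P I j (seqClass P I b μ (p, Word.single α)) =
      op (BoundGPA.arrow P I α) • Cone.tmul P I i (μ p) 1 := by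
  rw [val_seqClass, Word.elem, Cone.op_smul_tmul, one_mul]

theorem seqClass_snoc {j l : V} (p : τ) (s : Word κ i j) (c : κ j) (α : j ⟶ l) :
    seqClass P I b μ (p, s.snoc c α) =
      arrowMap P I α (op (b j c) • seqClass P I b μ (p, s)) := rfl

variable {P I}

theorem IsFoxDerivation.apply_seqClass_single
    {c : ∀ ⦃j j' : V⦄, (j ⟶ j') → (Cone P I i M →ₗ[k] k)}
    {Θ : Cone P I i M →ₗ[k] ∀ l, A l} (h : IsFoxDerivation c Θ) {j : V} (p : τ) (α : i ⟶ j) :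
    Θ (VertexModule.val P I j (seqClass P I b μ (p, Word.single α))) =
      c α (Cone.tmul P I i (μ p) 1) • inc j 1 := by
  rw [val_seqClass_single, h.arrow_smul]

theorem IsFoxDerivation.apply_seqClass_snoc
    {c : ∀ ⦃j j' : V⦄, (j ⟶ j') → (Cone P I i M →ₗ[k] k)}
    {Θ : Cone P I i M →ₗ[k] ∀ l, A l} (h : IsFoxDerivation c Θ) {j l : V} (p : τ)
    (s : Word κ i j) (d : κ j) (α : j ⟶ l) :
    Θ (VertexModule.val P I l (seqClass P I b μ (p, s.snoc d α))) =
      c α (op (BoundGPA.elem P I j (b j d)) •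
        VertexModule.val P I j (seqClass P I b μ (p, s))) • inc l 1 := by
  rw [seqClass_snoc, VertexModule.val_arrowMap, h.arrow_smul]
  rfl

theorem IsFoxDerivation.apply_seqClass {f : Cone P I i M →ₗ[k] k}
    {Θ : Cone P I i M →ₗ[k] ∀ l, A l} (h : IsFoxDerivation (arrowFunctional P I f) Θ) {j : V}
    (s : τ × Word κ i j) :
    Θ (VertexModule.val P I j (seqClass P I b μ s)) =
      f (VertexModule.val P I j (seqClass P I b μ s)) • inc j 1 := by
  obtain ⟨p, _ | ⟨s, d, α⟩⟩ := s
  · rw [h.apply_seqClass_single, val_seqClass_single]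
    rfl
  · rw [h.apply_seqClass_snoc]
    rfl

/-- The component at `j` of an `∏ A_l`-linear map on the cone, as an `A_j`-linear functional on the
module at `j`. -/
noncomputable def vertexDual (Θ : Cone P I i M →ₗ[k] ∀ l, A l)
    (hΘ : ∀ a x, Θ (op (BoundGPA.base P I a) • x) = Θ x * a) (j : V) :
    Module.Dual (A j)ᵐᵒᵖ (VertexModule P I (Cone P I i M) j) where
  toFun y := op (Θ (VertexModule.val P I j y) j)
  map_add' y z := by rw [map_add, map_add, Pi.add_apply, op_add]
  map_smul' a y := by
    rw [VertexModule.val_smul, BoundGPA.elem, hΘ, Pi.mul_apply, inc_same, op_mul, op_unop]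
    rfl

theorem linearIndependent_seqClass_of_dual {j : V} (S : Set (τ × Word κ i j))
    (h : ∀ s ∈ S, ∃ Θ : Cone P I i M →ₗ[k] ∀ l, A l,
      (∀ a x, Θ (op (BoundGPA.base P I a) • x) = Θ x * a) ∧
      Θ (VertexModule.val P I j (seqClass P I b μ s)) = inc j 1 ∧
      ∀ t ∈ S, t ≠ s → Θ (VertexModule.val P I j (seqClass P I b μ t)) = 0) :
    LinearIndependent (A j)ᵐᵒᵖ fun s : S => seqClass P I b μ s.1 := by
  choose Θ hΘ eq_one eq_zero using h
  refine .of_pairwise_dual_eq_zero_one _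
    (fun s => vertexDual (Θ s.1 s.2) (hΘ s.1 s.2) j) (fun s t hst => ?_) fun s => ?_
  · exact congrArg (fun r : ∀ l, A l => op (r j))
      (eq_zero s.1 s.2 t.1 t.2 (Subtype.coe_injective.ne hst.symm))
  · exact (congrArg (fun r : ∀ l, A l => op (r j)) (eq_one s.1 s.2)).trans (by
      rw [inc_same, op_one])

theorem linearIndependent_seqClass {j : V} {S : Set (τ × Word κ i j)}
    (hS : LinearIndepOn k (seqClass P I b μ) S) :
    LinearIndependent (A j)ᵐᵒᵖ fun s : S => seqClass P I b μ s.1 := by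
  have hval : LinearIndepOn k (fun s => VertexModule.val P I j (seqClass P I b μ s)) S :=
    hS.map' _ (LinearMap.ker_eq_bot.2 (VertexModule.val_injective P I j))
  obtain ⟨g, hg⟩ := (Finsupp.linearCombination k
    fun s : S => VertexModule.val P I j (seqClass P I b μ s.1)).exists_leftInverse_of_injective
      (LinearMap.ker_eq_bot.2 hval)
  have g_seqClass (t : S) :
      g (VertexModule.val P I j (seqClass P I b μ t.1)) = Finsupp.single t 1 := by
    simpa using LinearMap.congr_fun hg (Finsupp.single t 1)
  refine linearIndependent_seqClass_of_dual b μ S fun s hs => ?_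
  obtain ⟨Θ, hΘ⟩ := exists_isFoxDerivation_arrowFunctional P I
    (Finsupp.lapply (R := k) (⟨s, hs⟩ : S) ∘ₗ g)
  refine ⟨Θ, hΘ.base_smul, ?_, fun t ht hts => ?_⟩
  · rw [hΘ.apply_seqClass, LinearMap.comp_apply, g_seqClass ⟨s, hs⟩, Finsupp.lapply_apply,
      Finsupp.single_eq_same, one_smul]
  · rw [hΘ.apply_seqClass, LinearMap.comp_apply, g_seqClass ⟨t, ht⟩, Finsupp.lapply_apply,
      Finsupp.single_eq_of_ne (by simpa using hts.symm), zero_smul]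

end Dual

section Monomial

variable {k : Type*} [Field k] {V : Type*} [Quiver V] {A : V → Type*}
  [∀ i, Ring (A i)] [∀ i, Algebra k (A i)]
  {P : ∀ i, BoundPresentation k (A i)} {I : Set (Relation k V)}

section ArrowSingle

variable {N : Type*} [AddCommGroup N] [Module k N] {j l : V} (α : j ⟶ l) (f : N →ₗ[k] k)

/-- The family of functionals, one for each arrow, that is `f` at `α` and zero elsewhere. -/
noncomputable def arrowSingle ⦃j' l' : V⦄ (β : j' ⟶ l') : N →ₗ[k] k :=
  open scoped Classical in if (⟨j', l', β⟩ : Arrow V) = ⟨j, l, α⟩ then f else 0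

theorem arrowSingle_same : arrowSingle α f α = f := if_pos rfl

theorem arrowSingle_of_ne {j' l' : V} {β : j' ⟶ l'} (h : (⟨j', l', β⟩ : Arrow V) ≠ ⟨j, l, α⟩) :
    arrowSingle α f β = 0 := if_neg h

theorem arrowSingle_smul_eq_zero {W : Type*} [AddCommGroup W] [Module k W] {j' l' : V}
    {β : j' ⟶ l'} {x : N} (h : (⟨j', l', β⟩ : Arrow V) = ⟨j, l, α⟩ → f x = 0) (w : W) :
    arrowSingle α f β x • w = 0 := by
  by_cases hβ : (⟨j', l', β⟩ : Arrow V) = ⟨j, l, α⟩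
  · cases hβ
    rw [arrowSingle_same, h rfl, zero_smul]
  · rw [arrowSingle_of_ne α f hβ, LinearMap.zero_apply, zero_smul]

theorem isSourceSupported_arrowSingle [Module (BoundGPA P I)ᵐᵒᵖ N]
    (hf : ∀ x, f (op (BoundGPA.elem P I j 1) • x) = f x) :
    IsSourceSupported P I (arrowSingle α f) := fun j' l' β x => by
  by_cases h : (⟨j', l', β⟩ : Arrow V) = ⟨j, l, α⟩
  · cases h
    rw [arrowSingle_same, hf]
  · rw [arrowSingle_of_ne α f h, LinearMap.zero_apply, LinearMap.zero_apply]

end ArrowSingle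

theorem ContainsRelationPath.cons {i j l : V} {p : Quiver.Path i j}
    (h : ContainsRelationPath I p) (α : j ⟶ l) : ContainsRelationPath I (p.cons α) := by
  obtain ⟨ρ, hρ, q, hq, y, z, rfl⟩ := h
  exact ⟨ρ, hρ, q, hq, y, z.cons α, rfl⟩

theorem containsRelationPath_of_suffix {i l : V} {p : Quiver.Path i l} {ρ : Relation k V}
    (hρ : ρ ∈ I) {q : Quiver.Path ρ.src ρ.tgt} (hq : q ∈ ρ.coeff.support)
    {y : Quiver.Path i ρ.src}
    (h : (⟨ρ.tgt, y.comp q⟩ : Σ j, Quiver.Path i j) = ⟨l, p⟩) : ContainsRelationPath I p := by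
  cases h
  exact ⟨ρ, hρ, q, hq, y, .nil, rfl⟩

variable {i : V}

variable (P I) in
/-- The linear map `g` annihilates the right multiples `x · z a` by the elements `a` of `A_j` and
the interleavings `z` of the paths to `j` that are not final segments of `p`. -/
def VanishesOffSuffixes {N W : Type*} [AddCommGroup N] [Module k N] [Module (BoundGPA P I)ᵐᵒᵖ N]
    [AddCommGroup W] [Module k W] {j : V} (p : Quiver.Path i j) (g : N →ₗ[k] W) : Prop :=
  ∀ ⦃l : V⦄ (q : Quiver.Path l j) (z : GPA k A), IsInterleaving P q z →
    (∀ y : Quiver.Path i l, y.comp q ≠ p) → ∀ (a : A j) (x : N),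
      g (op (BoundGPA.mk P I z * BoundGPA.elem P I j a) • x) = 0

-- Both the Fox coordinate of `n · z` and, later, `Θ(x · z)` are of the form `D z`.
theorem VanishesOffSuffixes.eq_zero_of_isInterleaving {N : Type*} [AddCommGroup N] [Module k N]
    [Module (BoundGPA P I)ᵐᵒᵖ N] {j l : V} {p : Quiver.Path i j} {α : j ⟶ l} {f : N →ₗ[k] k}
    (hf : VanishesOffSuffixes P I p f) {D : GPA k A → ∀ l, A l} {x : N}
    (hD : ∀ {j' l'} (y) (β : j' ⟶ l'), D (y * GPA.arrow k A β) =
      arrowSingle α f β (op (BoundGPA.mk P I y) • x) • inc l' 1)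
    {m l' : V} {q : Quiver.Path m l'} {z : GPA k A} (hz : IsInterleaving P q z)
    (hq : ∀ y : Quiver.Path i m,
      (⟨l', y.comp q⟩ : Σ l, Quiver.Path i l) ≠ ⟨l, p.cons α⟩) : D z = 0 := by
  cases hz with
  | single β =>
    rw [← one_mul (GPA.arrow k A β), hD, arrowSingle_smul_eq_zero]
    intro hβ
    cases hβ
    exact absurd rfl (hq p)
  | @cons _ j' p' z β _ _ γ h =>
    rw [hD, arrowSingle_smul_eq_zero]
    intro hβ
    cases hβ
    rw [map_mul]
    exact hf p' z h (fun y hy => hq y (by rw [Quiver.Path.comp_cons, hy])) _ x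

variable {M : Type*} [AddCommGroup M] [Module k M] [Module (A i)ᵐᵒᵖ M]

theorem VanishesOffSuffixes.exists_isFoxDerivation {j l : V} {p : Quiver.Path i j} {α : j ⟶ l}
    {f : Cone P I i M →ₗ[k] k} (hf : VanishesOffSuffixes P I p f)
    (f_supp : ∀ x, f (op (BoundGPA.elem P I j 1) • x) = f x)
    (hp : ¬ ContainsRelationPath I (p.cons α)) :
    ∃ Θ : Cone P I i M →ₗ[k] ∀ l, A l,
      IsFoxDerivation (arrowSingle α f) Θ ∧ VanishesOffSuffixes P I (p.cons α) Θ := by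
  have hc := isSourceSupported_arrowSingle α f f_supp
  obtain ⟨Θ, hΘ⟩ := GBP.exists_isFoxDerivation P I i _ hc fun z hz n =>
    map_eq_zero_of_mem_boundSet (foxCoord P I _ hc n)
      (fun ρ hρ q hq z hz => hf.eq_zero_of_isInterleaving (foxCoord_mul_arrow P I _ hc n) hz
        fun y hy => hp (containsRelationPath_of_suffix hρ hq hy)) hz
  refine ⟨Θ, hΘ, fun m q z hz hq a x => ?_⟩
  have Θ_mk_smul : Θ (op (BoundGPA.mk P I z) • x) = 0 := by
    refine hf.eq_zero_of_isInterleaving (D := fun z => Θ (op (BoundGPA.mk P I z) • x)) (x := x)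
      (fun y β => ?_) hz fun y hy => hq y (eq_of_heq (Sigma.mk.inj hy).2)
    rw [map_mul, op_mul, mul_smul]
    exact hΘ.arrow_smul β _
  rw [op_mul, mul_smul, BoundGPA.elem, hΘ.base_smul, Θ_mk_smul, zero_mul]

variable (I) {κ : V → Type*} (b : ∀ l, Module.Basis (κ l) k (A l)) {τ : Type*}
  (μ : Module.Basis τ k M)

/-- `Θ` is an `∏ A_l`-linear functional on the cone that vanishes on `M` and is dual to the formal
sequence `m_p s` among all the formal sequences from `i` to `j`. -/
structure IsSequenceDual {j : V} (s : τ × Word κ i j) (Θ : Cone P I i M →ₗ[k] ∀ l, A l) : Prop where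
  tmul_one (m : M) : Θ (Cone.tmul P I i m 1) = 0
  base_smul (a : ∀ l, A l) (x : Cone P I i M) : Θ (op (BoundGPA.base P I a) • x) = Θ x * a
  apply_self : Θ (VertexModule.val P I j (seqClass P I b μ s)) = inc j 1
  apply_of_ne {t : τ × Word κ i j} (h : t ≠ s) :
    Θ (VertexModule.val P I j (seqClass P I b μ t)) = 0

variable {I}

theorem exists_isSequenceDual_snoc {p : τ} {j l : V} {s : Word κ i j}
    {Θ : Cone P I i M →ₗ[k] ∀ l, A l} (hΘ : IsSequenceDual I b μ (p, s) Θ)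
    (kill : VanishesOffSuffixes P I s.path Θ) (c : κ j) (α : j ⟶ l)
    (h : ¬ ContainsRelationPath I (s.path.cons α)) :
    ∃ Θ' : Cone P I i M →ₗ[k] ∀ l, A l, VanishesOffSuffixes P I (s.path.cons α) Θ' ∧
      IsSequenceDual I b μ (p, s.snoc c α) Θ' := by
  let f : Cone P I i M →ₗ[k] k := (b j).coord c ∘ₗ LinearMap.proj j ∘ₗ Θ
  have f_smul (a : A j) (x : Cone P I i M) :
      f (op (BoundGPA.elem P I j a) • x) = (b j).coord c (Θ x j * a) := by
    refine congrArg ((b j).coord c) ((congrFun (hΘ.base_smul _ x) j).trans ?_)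
    rw [Pi.mul_apply, inc_same]
  have f_kill : VanishesOffSuffixes P I s.path f := fun m q z hz hq a x =>
    congrArg (fun r : ∀ l, A l => (b j).coord c (r j)) (kill q z hz hq a x) |>.trans (map_zero _)
  obtain ⟨Θ', hΘ', kill'⟩ := f_kill.exists_isFoxDerivation (α := α)
    (fun x => by rw [f_smul, mul_one]; rfl) h
  refine ⟨Θ', kill', hΘ'.tmul_one, hΘ'.base_smul, ?_, ?_⟩
  · rw [hΘ'.apply_seqClass_snoc, arrowSingle_same, f_smul, hΘ.apply_self, inc_same, one_mul,
      Module.Basis.coord_apply, Module.Basis.repr_self, Finsupp.single_eq_same, one_smul]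
  · rintro ⟨p', β | ⟨t, d, β⟩⟩ hne
    · rw [hΘ'.apply_seqClass_single, arrowSingle_smul_eq_zero]
      intro hβ
      cases hβ
      change (b i).coord c (Θ _ i) = 0
      rw [hΘ.tmul_one, Pi.zero_apply, map_zero]
    · rw [hΘ'.apply_seqClass_snoc, arrowSingle_smul_eq_zero]
      intro hβ
      cases hβ
      rw [f_smul]
      by_cases ht : (p', t) = (p, s)
      · cases ht
        rw [hΘ.apply_self, inc_same, one_mul, Module.Basis.coord_apply, Module.Basis.repr_self,
          Finsupp.single_eq_of_ne fun hd => hne (by rw [hd])]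
      · rw [hΘ.apply_of_ne ht, Pi.zero_apply, zero_mul, map_zero]

theorem Word.exists_elem_eq_mul_arrow {j : V} (s : Word κ i j) :
    ∃ (l : V) (α : l ⟶ j) (u : BoundGPA P I), s.elem P I b = u * BoundGPA.arrow P I α := by
  cases s with
  | single α => exact ⟨_, α, 1, (one_mul _).symm⟩
  | snoc s c α => exact ⟨_, α, _, rfl⟩

variable [IsScalarTower k (A i)ᵐᵒᵖ M]

theorem Cone.retraction_seqClass {j : V} (s : τ × Word κ i j) :
    Cone.retraction P I i M (VertexModule.val P I j (seqClass P I b μ s)) = 0 := by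
  obtain ⟨l, α, u, hu⟩ := s.2.exists_elem_eq_mul_arrow (P := P) (I := I) b
  rw [val_seqClass, hu, ← op_smul_tmul, retraction_arrow_smul]

theorem vanishesOffSuffixes_comp_retraction (g : M →ₗ[k] k) :
    VanishesOffSuffixes P I (.nil : Quiver.Path i i) (g ∘ₗ Cone.retraction P I i M) := by
  intro m q z hz _ a x
  obtain ⟨l, β, y, rfl⟩ := hz.exists_eq_mul_arrow
  rw [LinearMap.comp_apply, Cone.retraction_op_smul, map_mul, map_mul, map_mul]
  refine (congrArg (fun r : ∀ l, A l => g (op ((BoundGPA.augmentation P I (BoundGPA.mk P I y) * r *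
    BoundGPA.augmentation P I (BoundGPA.elem P I i a)) i) • Cone.retraction P I i M x))
    (BoundGPA.augmentation_arrow P I β)).trans ?_
  rw [mul_zero, zero_mul, Pi.zero_apply, op_zero, zero_smul, map_zero]

theorem exists_isSequenceDual_single (p : τ) {j : V} (α : i ⟶ j)
    (h : ¬ ContainsRelationPath I ((Quiver.Path.nil : Quiver.Path i i).cons α)) :
    ∃ Θ : Cone P I i M →ₗ[k] ∀ l, A l, VanishesOffSuffixes P I (Quiver.Path.nil.cons α) Θ ∧
      IsSequenceDual I b μ (p, Word.single α) Θ := by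
  obtain ⟨Θ, hΘ, kill⟩ := (vanishesOffSuffixes_comp_retraction (μ.coord p)).exists_isFoxDerivation
    (α := α) (fun x => congrArg (μ.coord p) (Cone.retraction_elem_one_smul P I i x)) h
  refine ⟨Θ, kill, hΘ.tmul_one, hΘ.base_smul, ?_, ?_⟩
  · rw [hΘ.apply_seqClass_single, arrowSingle_same, LinearMap.comp_apply,
      Cone.retraction_tmul_one, Module.Basis.coord_apply, Module.Basis.repr_self,
      Finsupp.single_eq_same, one_smul]
  · rintro ⟨p', β | ⟨t, d, β⟩⟩ hne
    · rw [hΘ.apply_seqClass_single, arrowSingle_smul_eq_zero]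
      intro hβ
      cases hβ
      rw [LinearMap.comp_apply, Cone.retraction_tmul_one, Module.Basis.coord_apply,
        Module.Basis.repr_self, Finsupp.single_eq_of_ne fun hp => hne (by rw [hp])]
    · rw [hΘ.apply_seqClass_snoc, arrowSingle_smul_eq_zero]
      intro hβ
      cases hβ
      rw [LinearMap.comp_apply, Cone.retraction_op_smul, Cone.retraction_seqClass, smul_zero,
        map_zero]

theorem exists_isSequenceDual (p : τ) {j : V} (s : Word κ i j)
    (h : ¬ ContainsRelationPath I s.path) :
    ∃ Θ : Cone P I i M →ₗ[k] ∀ l, A l, VanishesOffSuffixes P I s.path Θ ∧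
      IsSequenceDual I b μ (p, s) Θ := by
  induction s with
  | single α => exact exists_isSequenceDual_single b μ p α h
  | snoc s c α ih =>
    obtain ⟨Θ, kill, hΘ⟩ := ih fun hs => h (hs.cons α)
    exact exists_isSequenceDual_snoc b μ hΘ kill c α h

theorem linearIndependent_seqClass_of_not_containsRelationPath (j : V) :
    LinearIndependent (A j)ᵐᵒᵖ
      fun s : {s : τ × Word κ i j // ¬ ContainsRelationPath I s.2.path} =>
        seqClass P I b μ s.1 :=
  linearIndependent_seqClass_of_dual b μ {s | ¬ ContainsRelationPath I s.2.path} fun s hs => by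
    obtain ⟨Θ, -, hΘ⟩ := exists_isSequenceDual b μ s.1 s.2 hs
    exact ⟨Θ, hΘ.base_smul, hΘ.apply_self, fun t _ => hΘ.apply_of_ne⟩

end Monomial

section Spanning

variable {k : Type*} [Field k] {V : Type*} [Quiver V] {A : V → Type*}
  [∀ i, Ring (A i)] [∀ i, Algebra k (A i)]
  (P : ∀ i, BoundPresentation k (A i)) (I : Set (Relation k V)) {i : V}
  {M : Type*} [AddCommGroup M] [Module k M] [Module (A i)ᵐᵒᵖ M]

theorem vertexProj_tmul_one_of_ne {j : V} (h : j ≠ i) (m : M) :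
    vertexProj P I (Cone P I i M) j (Cone.tmul P I i m 1) = 0 := by
  apply VertexModule.val_injective P I
  rw [val_vertexProj, BoundGPA.elem, Cone.base_smul_tmul_one, inc_of_ne h.symm, op_zero, zero_smul,
    map_zero]
  exact map_zero ((Cone.tmulHom P I i M).flip 1)

variable (M) in
/-- The map `m ↦ m ⊗ 1` from `M` to the component of the cone at `i`. -/
noncomputable def coneUnit : M →ₗ[(A i)ᵐᵒᵖ] VertexModule P I (Cone P I i M) i where
  toFun m := vertexProj P I (Cone P I i M) i (Cone.tmul P I i m 1)
  map_add' m n := (congrArg _ (map_add ((Cone.tmulHom P I i M).flip 1) m n)).trans (map_add _ _ _)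
  map_smul' a m := by
    have tmul_smul : Cone.tmul P I i (a • m) 1 =
        op (BoundGPA.base P I (inc i a.unop)) • Cone.tmul P I i m 1 := by
      rw [Cone.base_smul_tmul_one, inc_same, op_unop]
    rw [tmul_smul, vertexProj_base_smul, inc_same, op_unop, RingHom.id_apply]

theorem val_coneUnit (m : M) :
    VertexModule.val P I i (coneUnit P I M m) = Cone.tmul P I i m 1 := by
  refine (val_vertexProj P I i _).trans ?_
  rw [BoundGPA.elem, Cone.base_smul_tmul_one, inc_same, op_one, one_smul]

theorem coneUnit_injective [IsScalarTower k (A i)ᵐᵒᵖ M] :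
    Function.Injective (coneUnit P I (i := i) M) :=
  Function.LeftInverse.injective (g := fun y => Cone.retraction P I i M (VertexModule.val P I i y))
    fun m => (congrArg _ (val_coneUnit P I m)).trans (Cone.retraction_tmul_one P I i m)

variable {κ : V → Type*} (b : ∀ l, Module.Basis (κ l) k (A l)) {τ : Type*}
  (μ : Module.Basis τ k M)

theorem seqClass_single {j : V} (p : τ) (α : i ⟶ j) : seqClass P I b μ (p, Word.single α) =
    arrowMap P I α (coneUnit P I M (μ p)) := by
  apply VertexModule.val_injective P I
  rw [VertexModule.val_arrowMap, val_coneUnit, val_seqClass_single]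

theorem apply_mem_of_basis_mem {R E F ι : Type*} [Semiring R] [AddCommMonoid E] [Module R E]
    [AddCommMonoid F] [Module R F] (B : Module.Basis ι R E) (g : E →ₗ[R] F) {U : Submodule R F}
    (h : ∀ t, g (B t) ∈ U) (x : E) : g x ∈ U :=
  (B.span_eq ▸ Submodule.span_le.2 (Set.range_subset_iff.2 h) : ⊤ ≤ U.comap g) trivial

/-- The `A_j`-submodule of the component of the cone at `j` that is generated by the components of
the elements of `M` and by the classes of the formal sequences. -/
noncomputable def coneSpan (j : V) : Submodule (A j)ᵐᵒᵖ (VertexModule P I (Cone P I i M) j) :=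
  Submodule.span _ (Set.range (fun m => vertexProj P I (Cone P I i M) j (Cone.tmul P I i m 1)) ∪
    Set.range (seqClass P I b μ))

theorem seqClass_mem_coneSpan {j : V} (s : τ × Word κ i j) :
    seqClass P I b μ s ∈ coneSpan P I b μ j :=
  Submodule.subset_span (.inr ⟨s, rfl⟩)

theorem arrowMap_vertexProj_tmul_one_mem {j j' : V} (α : j ⟶ j') (m : M) :
    arrowMap P I α (vertexProj P I (Cone P I i M) j (Cone.tmul P I i m 1)) ∈
      coneSpan P I b μ j' := by
  refine apply_mem_of_basis_mem μ (arrowMap P I α ∘ₗ vertexProj P I (Cone P I i M) j ∘ₗ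
    (Cone.tmulHom P I i M).flip 1) (U := (coneSpan P I b μ j').restrictScalars k) (fun p => ?_) m
  change arrowMap P I α (vertexProj P I (Cone P I i M) j (Cone.tmul P I i (μ p) 1)) ∈ _
  by_cases h : j = i
  · subst h
    exact seqClass_single P I b μ p α ▸ seqClass_mem_coneSpan P I b μ _
  · rw [vertexProj_tmul_one_of_ne P I h, map_zero]
    exact Submodule.zero_mem _

theorem arrowMap_smul_seqClass_mem {j j' : V} (α : j ⟶ j') (a : (A j)ᵐᵒᵖ) (s : τ × Word κ i j) :
    arrowMap P I α (a • seqClass P I b μ s) ∈ coneSpan P I b μ j' :=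
  apply_mem_of_basis_mem ((b j).map (opLinearEquiv k)) (arrowMap P I α ∘ₗ
    (LinearMap.toSpanSingleton (A j)ᵐᵒᵖ _ (seqClass P I b μ s)).restrictScalars k)
    (U := (coneSpan P I b μ j').restrictScalars k)
    (fun c => seqClass_mem_coneSpan P I b μ (s.1, s.2.snoc c α)) a

theorem arrowMap_mem_coneSpan {j j' : V} (α : j ⟶ j') {y : VertexModule P I (Cone P I i M) j}
    (hy : y ∈ coneSpan P I b μ j) : arrowMap P I α y ∈ coneSpan P I b μ j' := by
  suffices h : ∀ a : (A j)ᵐᵒᵖ, arrowMap P I α (a • y) ∈ coneSpan P I b μ j' from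
    one_smul (A j)ᵐᵒᵖ y ▸ h 1
  induction hy using Submodule.span_induction with
  | mem y h =>
    intro a
    rcases h with ⟨m, rfl⟩ | ⟨s, rfl⟩
    · have smul_eq : a • vertexProj P I (Cone P I i M) j (Cone.tmul P I i m 1) =
          vertexProj P I (Cone P I i M) j
            (Cone.tmul P I i (op ((inc j a.unop : ∀ l, A l) i) • m) 1) := by
        rw [← Cone.base_smul_tmul_one, vertexProj_base_smul, inc_same, op_unop]
      exact smul_eq ▸ arrowMap_vertexProj_tmul_one_mem P I b μ α _
    · exact arrowMap_smul_seqClass_mem P I b μ α a s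
  | zero => exact fun a => by rw [smul_zero, map_zero]; exact Submodule.zero_mem _
  | add y z _ _ hy hz =>
    exact fun a => by rw [smul_add, map_add]; exact Submodule.add_mem _ (hy a) (hz a)
  | smul r y _ hy => exact fun a => mul_smul a r y ▸ hy (a * r)

theorem coneSpan_eq_top (j : V) : coneSpan P I (i := i) b μ j = ⊤ := by
  suffices h : ∀ (x : Cone P I i M) (j : V),
      vertexProj P I (Cone P I i M) j x ∈ coneSpan P I b μ j from
    eq_top_iff.2 fun y _ => vertexProj_val P I j y ▸ h _ j
  intro x
  induction x using Cone.induction with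
  | tmul_one m => exact fun j => Submodule.subset_span (.inl ⟨m, rfl⟩)
  | add x y hx hy =>
    exact fun j => map_add (vertexProj P I (Cone P I i M) j) x y ▸ add_mem (hx j) (hy j)
  | base_smul a x hx =>
    exact fun j => vertexProj_base_smul P I j a x ▸ Submodule.smul_mem _ _ (hx j)
  | @arrow_smul l l' α x hx =>
    intro j
    by_cases h : l' = j
    · subst h
      exact vertexProj_arrow_smul P I α x ▸ arrowMap_mem_coneSpan P I b μ α (hx l)
    · exact vertexProj_arrow_smul_of_ne P I h α x ▸ Submodule.zero_mem _

theorem span_seqClass {j : V} (h : j ≠ i) :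
    Submodule.span (A j)ᵐᵒᵖ (Set.range (seqClass P I (i := i) b μ (j := j))) = ⊤ := by
  rw [eq_top_iff, ← coneSpan_eq_top P I b μ j, coneSpan, Submodule.span_le, Set.union_subset_iff]
  refine ⟨Set.range_subset_iff.2 fun m => ?_, Submodule.subset_span⟩
  exact vertexProj_tmul_one_of_ne P I h m ▸ Submodule.zero_mem _

theorem Word.length_path_pos {j : V} (s : Word κ i j) : 0 < s.path.length := by
  cases s <;> exact Nat.succ_pos _

include b μ in
theorem coneUnit_surjective (hi : ∀ p : Quiver.Path i i, p.length = 0) :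
    Function.Surjective (coneUnit P I (i := i) M) := by
  rw [← LinearMap.range_eq_top, eq_top_iff, ← coneSpan_eq_top P I b μ i, coneSpan,
    Submodule.span_le, Set.union_subset_iff]
  exact ⟨Set.range_subset_iff.2 fun m => ⟨m, rfl⟩,
    Set.range_subset_iff.2 fun s => absurd (hi s.2.path) s.2.length_path_pos.ne'⟩

/-- Since no oriented cycle passes through `i`, the component of the cone at `i` is `M`. -/
noncomputable def coneUnitEquiv [IsScalarTower k (A i)ᵐᵒᵖ M]
    (hi : ∀ p : Quiver.Path i i, p.length = 0) :
    M ≃ₗ[(A i)ᵐᵒᵖ] VertexModule P I (Cone P I i M) i :=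
  .ofBijective (coneUnit P I M) ⟨coneUnit_injective P I, coneUnit_surjective P I b μ hi⟩

theorem arrowMap_ext_of_ne {j j' : V} (h : j ≠ i) {φ ψ : VertexModule P I (Cone P I i M) j →ₗ[k]
    VertexModule P I (Cone P I i M) j'}
    (eq : ∀ (s : τ × Word κ i j) (c : κ j),
      φ (op (b j c) • seqClass P I b μ s) = ψ (op (b j c) • seqClass P I b μ s)) : φ = ψ := by
  have span_op : Submodule.span k (Set.range fun c => op (b j c)) = ⊤ :=
    ((b j).map (opLinearEquiv k)).span_eq
  have span_smul := Submodule.span_smul_of_span_eq_top span_op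
    (Set.range (seqClass P I (i := i) b μ (j := j)))
  rw [span_seqClass P I b μ h, Submodule.restrictScalars_top] at span_smul
  refine LinearMap.ext_on span_smul ?_
  rintro _ ⟨_, ⟨c, rfl⟩, _, ⟨s, rfl⟩, rfl⟩
  exact eq s c

end Spanning

section Vanishing

variable {k : Type*} [Field k] {V : Type*} [Quiver V] {A : V → Type*}
  [∀ i, Ring (A i)] [∀ i, Algebra k (A i)]
  (P : ∀ i, BoundPresentation k (A i)) (I : Set (Relation k V))

/-- The image of `A_l` in `Λ`. -/
noncomputable def elemSpan (l : V) : Submodule k (BoundGPA P I) :=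
  LinearMap.range (BoundGPA.elemLinear P I l)

theorem elem_mem_elemSpan (l : V) (a : A l) : BoundGPA.elem P I l a ∈ elemSpan P I l :=
  ⟨a, rfl⟩

theorem elemSpan_mul_self (l : V) : elemSpan P I l * elemSpan P I l = elemSpan P I l := by
  refine le_antisymm (Submodule.mul_le.2 ?_) ?_
  · rintro _ ⟨a, rfl⟩ _ ⟨a', rfl⟩
    exact ⟨a * a', BoundGPA.elem_mul P I l a a'⟩
  · rintro _ ⟨a, rfl⟩
    change BoundGPA.elem P I l a ∈ _
    rw [← mul_one a, BoundGPA.elem_mul]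
    exact Submodule.mul_mem_mul (elem_mem_elemSpan P I l a) (elem_mem_elemSpan P I l 1)

/-- The span in `Λ` of the elements `a_1 β_1 a_2 ⋯ a_n β_n a_{n+1}` along the path `β_1 ⋯ β_n`. -/
noncomputable def pathSpan : {i j : V} → Quiver.Path i j → Submodule k (BoundGPA P I)
  | i, _, .nil => elemSpan P I i
  | _, j, .cons p β => pathSpan p * Submodule.span k {BoundGPA.arrow P I β} * elemSpan P I j

theorem pathSpan_mul_elemSpan {i j : V} (p : Quiver.Path i j) :
    pathSpan P I p * elemSpan P I j = pathSpan P I p := by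
  cases p with
  | nil => rw [pathSpan, elemSpan_mul_self]
  | cons p β => rw [pathSpan, mul_assoc, elemSpan_mul_self]

theorem pathSpan_comp {i j l : V} (p : Quiver.Path i j) (q : Quiver.Path j l) :
    pathSpan P I (p.comp q) = pathSpan P I p * pathSpan P I q := by
  induction q with
  | nil => rw [Quiver.Path.comp_nil, pathSpan, pathSpan_mul_elemSpan]
  | cons q β ih => simp only [Quiver.Path.comp_cons, pathSpan, ih, mul_assoc]

theorem Word.elem_mem_pathSpan {κ : V → Type*} (b : ∀ l, Module.Basis (κ l) k (A l)) {i j : V}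
    (s : Word κ i j) : s.elem P I b ∈ pathSpan P I s.path := by
  induction s with
  | single α =>
    rw [Word.elem, ← BoundGPA.arrow_mul_elem, ← BoundGPA.elem_one_mul_arrow, Word.path, pathSpan,
      pathSpan]
    exact Submodule.mul_mem_mul (Submodule.mul_mem_mul (elem_mem_elemSpan P I i 1)
      (Submodule.mem_span_singleton_self _)) (elem_mem_elemSpan P I _ 1)
  | @snoc j l s c α ih =>
    rw [Word.elem, ← BoundGPA.arrow_mul_elem, ← mul_assoc, Word.path, pathSpan]
    refine Submodule.mul_mem_mul (Submodule.mul_mem_mul ?_ (Submodule.mem_span_singleton_self _))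
      (elem_mem_elemSpan P I l 1)
    exact pathSpan_mul_elemSpan P I s.path ▸
      Submodule.mul_mem_mul ih (elem_mem_elemSpan P I j (b j c))

/-- The span in `Λ` of the interleavings of a path. -/
noncomputable def interleavingSpan {i j : V} (p : Quiver.Path i j) : Submodule k (BoundGPA P I) :=
  Submodule.span k (BoundGPA.mk P I '' {z | IsInterleaving P p z})

theorem elemSpan_eq_span (l : V) : elemSpan P I l = Submodule.span k
    (BoundGPA.elem P I l '' {x | ∃ (a b : (P l).vertices) (γ : Quiver.Path a b),
      x = (P l).proj (pathElem k γ)}) := by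
  rw [elemSpan, LinearMap.range_eq_map, ← (P l).span_proj, Submodule.map_span]
  rfl

theorem interleavingSpan_mul_le {i j l : V} (p : Quiver.Path i j) (β : j ⟶ l) :
    interleavingSpan P I p * elemSpan P I j * Submodule.span k {BoundGPA.arrow P I β} ≤
      interleavingSpan P I (p.cons β) := by
  rw [interleavingSpan, elemSpan_eq_span, Submodule.span_mul_span, Submodule.span_mul_span,
    Submodule.span_le]
  rintro _ ⟨_, ⟨_, ⟨z, hz, rfl⟩, _, ⟨_, ⟨a, b, γ, rfl⟩, rfl⟩, rfl⟩, _, rfl, rfl⟩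
  exact Submodule.subset_span ⟨_, .cons p z β γ hz, by rw [map_mul, map_mul]; rfl⟩

theorem pathSpan_cons_le {i j l : V} (p : Quiver.Path i j) (β : j ⟶ l) :
    pathSpan P I (p.cons β) ≤
      elemSpan P I i * interleavingSpan P I (p.cons β) * elemSpan P I l := by
  induction p generalizing l with
  | nil =>
    rw [pathSpan, pathSpan, interleavingSpan]
    gcongr
    exact Set.singleton_subset_iff.2 ⟨_, .single β, rfl⟩
  | @cons m n p α ih =>
    rw [pathSpan]
    calc pathSpan P I (p.cons α) * Submodule.span k {BoundGPA.arrow P I β} * elemSpan P I l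
      _ ≤ elemSpan P I i * interleavingSpan P I (p.cons α) * elemSpan P I n *
            Submodule.span k {BoundGPA.arrow P I β} * elemSpan P I l := by gcongr; exact ih α
      _ = elemSpan P I i * (interleavingSpan P I (p.cons α) * elemSpan P I n *
            Submodule.span k {BoundGPA.arrow P I β}) * elemSpan P I l := by
          simp only [mul_assoc]
      _ ≤ _ := by gcongr; exact interleavingSpan_mul_le P I _ β

variable {I}

theorem interleavingSpan_eq_bot (hI : IsMonomial I) {ρ : Relation k V} (hρ : ρ ∈ I)
    {q : Quiver.Path ρ.src ρ.tgt} (hq : q ∈ ρ.coeff.support) : interleavingSpan P I q = ⊥ := by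
  obtain ⟨q', c, hc, coeff_eq⟩ := hI ρ hρ
  obtain rfl : q = q' := by
    rw [coeff_eq, Finsupp.mem_support_single] at hq
    exact hq.1
  refine Submodule.span_eq_bot.2 ?_
  rintro _ ⟨z, hz, rfl⟩
  have smul_mem : c • z ∈ boundSet P I := by
    refine ⟨ρ, hρ, fun _ => z, fun p hp => ?_, ?_⟩
    · rw [coeff_eq, Finsupp.mem_support_single] at hp
      exact hp.1 ▸ hz
    · rw [coeff_eq, Finsupp.sum_single_index (zero_smul k z)]
  have smul_mk_eq_zero : c • BoundGPA.mk P I z = 0 :=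
    (map_smul _ c z).symm.trans (BoundGPA.mk_eq_zero P I smul_mem)
  exact (smul_eq_zero.1 smul_mk_eq_zero).resolve_left hc

theorem pathSpan_eq_bot (hI : IsMonomial I) {i j : V} {p : Quiver.Path i j}
    (hp : ContainsRelationPath I p) : pathSpan P I p = ⊥ := by
  obtain ⟨ρ, hρ, q, hq, y, z, rfl⟩ := hp
  have relation_eq_bot : pathSpan P I q = ⊥ := by
    obtain ⟨l, q', β, rfl⟩ := (Quiver.Path.length_ne_zero_iff_eq_cons q).1
      (by have := ρ.two_le q hq; omega)
    refine le_bot_iff.1 ((pathSpan_cons_le P I q' β).trans_eq ?_)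
    rw [interleavingSpan_eq_bot P hI hρ hq, Submodule.mul_bot, Submodule.bot_mul]
  rw [pathSpan_comp, pathSpan_comp, relation_eq_bot, Submodule.mul_bot, Submodule.bot_mul]

theorem seqClass_eq_zero (hI : IsMonomial I) {i j : V} {M : Type*} [AddCommGroup M] [Module k M]
    [Module (A i)ᵐᵒᵖ M] {κ : V → Type*} (b : ∀ l, Module.Basis (κ l) k (A l)) {τ : Type*}
    (μ : Module.Basis τ k M) {s : τ × Word κ i j} (hs : ContainsRelationPath I s.2.path) :
    seqClass P I b μ s = 0 := by
  have elem_eq_zero : s.2.elem P I b = 0 :=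
    (Submodule.mem_bot k).1 (pathSpan_eq_bot P hI hs ▸ s.2.elem_mem_pathSpan P I b)
  apply VertexModule.val_injective P I
  rw [val_seqClass, elem_eq_zero, map_zero]
  exact map_zero (Cone.tmulHom P I i M (μ s.1))

end Vanishing

theorem exists_linearIndepOn_span_image_eq {K E ι : Type*} [DivisionRing K] [AddCommGroup E]
    [Module K E] (f : ι → E) : ∃ S : Set ι, LinearIndepOn K f S ∧
      Submodule.span K (f '' S) = Submodule.span K (Set.range f) := by
  obtain ⟨S, -, -, range_le, independent⟩ := exists_linearIndepOn_extension (t := Set.univ)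
    (linearIndepOn_empty K f) (Set.empty_subset _)
  rw [Set.image_univ] at range_le
  exact ⟨S, independent, (Submodule.span_mono (Set.image_subset_range f S)).antisymm
    (Submodule.span_le.2 range_le)⟩

section Representation

variable {k : Type*} [Field k] {V : Type*} [Quiver V] {A : V → Type*}
  [∀ i, Ring (A i)] [∀ i, Algebra k (A i)]
  (P : ∀ i, BoundPresentation k (A i)) (I : Set (Relation k V)) {i : V}
  {M : Type*} [AddCommGroup M] [Module k M] [Module (A i)ᵐᵒᵖ M]
  {κ : V → Type*} (b : ∀ l, Module.Basis (κ l) k (A l)) {τ : Type*} (μ : Module.Basis τ k M)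

theorem exists_basis_seqClass {j : V} (h : j ≠ i) {S : Set (τ × Word κ i j)}
    (hS : LinearIndepOn k (seqClass P I b μ) S)
    (span_eq : Submodule.span k (seqClass P I b μ '' S) =
      Submodule.span k (Set.range (seqClass P I b μ (j := j)))) :
    ∃ B : Module.Basis S (A j)ᵐᵒᵖ (VertexModule P I (Cone P I i M) j),
      ∀ s : S, B s = seqClass P I b μ s.1 := by
  have top_le : ⊤ ≤ Submodule.span (A j)ᵐᵒᵖ (Set.range fun s : S => seqClass P I b μ s.1) := by
    rw [← Set.image_eq_range, ← Submodule.span_span_of_tower k, span_eq,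
      Submodule.span_span_of_tower, span_seqClass P I b μ h]
  exact ⟨.mk (linearIndependent_seqClass b μ hS) top_le, Module.Basis.mk_apply _ _⟩

theorem eq_arrowMap_iff_of_ne {j j' : V} (h : j ≠ i) (α : j ⟶ j')
    (φ : VertexModule P I (Cone P I i M) j →ₗ[k] VertexModule P I (Cone P I i M) j') :
    φ = arrowMap P I α ↔ ∀ (p : τ) (s : Word κ i j) (c : κ j),
      φ (op (b j c) • seqClass P I b μ (p, s)) = seqClass P I b μ (p, s.snoc c α) :=
  ⟨fun eq _ _ _ => eq ▸ rfl, fun eq => arrowMap_ext_of_ne P I b μ h fun s c => eq s.1 s.2 c⟩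

variable [IsScalarTower k (A i)ᵐᵒᵖ M]

variable {I} in
theorem exists_basis_seqClass_of_isMonomial (hI : IsMonomial I) {j : V} (h : j ≠ i) :
    ∃ B : Module.Basis {s : τ × Word κ i j // ¬ ContainsRelationPath I s.2.path}
        (A j)ᵐᵒᵖ (VertexModule P I (Cone P I i M) j),
      ∀ s, B s = seqClass P I b μ s.1 := by
  have top_le : ⊤ ≤ Submodule.span (A j)ᵐᵒᵖ (Set.range
      fun s : {s : τ × Word κ i j // ¬ ContainsRelationPath I s.2.path} =>
        seqClass P I b μ s.1) := by
    rw [← span_seqClass P I b μ h, Submodule.span_le, Set.range_subset_iff]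
    intro s
    by_cases hs : ContainsRelationPath I s.2.path
    · exact seqClass_eq_zero P hI b μ hs ▸ Submodule.zero_mem _
    · exact Submodule.subset_span ⟨⟨s, hs⟩, rfl⟩
  exact ⟨.mk (linearIndependent_seqClass_of_not_containsRelationPath b μ j) top_le,
    Module.Basis.mk_apply _ _⟩

theorem eq_arrowMap_iff (hi : ∀ p : Quiver.Path i i, p.length = 0) {j' : V} (α : i ⟶ j')
    (φ : VertexModule P I (Cone P I i M) i →ₗ[k] VertexModule P I (Cone P I i M) j') :
    φ = arrowMap P I α ↔
      ∀ p, φ (coneUnitEquiv P I b μ hi (μ p)) = seqClass P I b μ (p, Word.single α) := by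
  refine ⟨fun h p => h ▸ (seqClass_single P I b μ p α).symm, fun h => ?_⟩
  exact (μ.map ((coneUnitEquiv P I b μ hi).restrictScalars k)).ext fun p =>
    (h p).trans (seqClass_single P I b μ p α)

end Representation

end GBP

theorem proposition4p3_general
    {k : Type*} [Field k] {V : Type*} [Quiver V]
    {A : V → Type*} [∀ l, Ring (A l)] [∀ l, Algebra k (A l)]
    (P : ∀ l, GBP.BoundPresentation k (A l)) (I : Set (GBP.Relation k V))
    (i : V) (hi : ∀ p : Quiver.Path i i, p.length = 0)
    {M : Type*} [AddCommGroup M] [Module k M] [Module (A i)ᵐᵒᵖ M] [IsScalarTower k (A i)ᵐᵒᵖ M]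
    {κ : V → Type*} (b : ∀ l, Module.Basis (κ l) k (A l))
    {τ : Type*} (μ : Module.Basis τ k M) :
    (∃ f : M ≃ₗ[(A i)ᵐᵒᵖ] GBP.VertexModule P I (GBP.Cone P I i M) i,
      (∀ m, GBP.VertexModule.val P I i (f m) = GBP.Cone.tmul P I i m 1) ∧
      ∀ (j' : V) (α : i ⟶ j')
        (φ : GBP.VertexModule P I (GBP.Cone P I i M) i →ₗ[k]
          GBP.VertexModule P I (GBP.Cone P I i M) j'),
        φ = GBP.arrowMap P I α ↔
          ∀ p : τ, φ (f (μ p)) = GBP.seqClass P I b μ (p, GBP.Word.single α)) ∧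
    (∀ j : V, j ≠ i →
      (∃ S : Set (τ × GBP.Word κ i j),
        LinearIndepOn k (GBP.seqClass P I b μ) S ∧
        Submodule.span k (GBP.seqClass P I b μ '' S) =
          Submodule.span k (Set.range (GBP.seqClass P I b μ (j := j)))) ∧
      (∀ S : Set (τ × GBP.Word κ i j),
        LinearIndepOn k (GBP.seqClass P I b μ) S →
        Submodule.span k (GBP.seqClass P I b μ '' S) =
          Submodule.span k (Set.range (GBP.seqClass P I b μ (j := j))) →
        ∃ B : Module.Basis S (A j)ᵐᵒᵖ (GBP.VertexModule P I (GBP.Cone P I i M) j),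
          ∀ s : S, B s = GBP.seqClass P I b μ s.1) ∧
      (GBP.IsMonomial I →
        (∀ s : τ × GBP.Word κ i j, GBP.ContainsRelationPath I s.2.path →
          GBP.seqClass P I b μ s = 0) ∧
        ∃ B : Module.Basis
            {s : τ × GBP.Word κ i j // ¬ GBP.ContainsRelationPath I s.2.path}
            (A j)ᵐᵒᵖ (GBP.VertexModule P I (GBP.Cone P I i M) j),
          ∀ s, B s = GBP.seqClass P I b μ s.1)) ∧
    (∀ (j j' : V) (α : j ⟶ j'), j ≠ i →
      ∀ φ : GBP.VertexModule P I (GBP.Cone P I i M) j →ₗ[k]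
          GBP.VertexModule P I (GBP.Cone P I i M) j',
        φ = GBP.arrowMap P I α ↔
          ∀ (p : τ) (s : GBP.Word κ i j) (c : κ j),
            φ (op (b j c) • GBP.seqClass P I b μ (p, s)) =
              GBP.seqClass P I b μ (p, s.snoc c α)) :=
  ⟨⟨GBP.coneUnitEquiv P I b μ hi, GBP.val_coneUnit P I,
      fun _ => GBP.eq_arrowMap_iff P I b μ hi⟩,
    fun _ h => ⟨GBP.exists_linearIndepOn_span_image_eq _,
      fun _ => GBP.exists_basis_seqClass P I b μ h,
      fun hI => ⟨fun _ => GBP.seqClass_eq_zero P hI b μ,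
        GBP.exists_basis_seqClass_of_isMonomial P b μ hI h⟩⟩,
    fun _ _ α h => GBP.eq_arrowMap_iff_of_ne P I b μ h α⟩

theorem proposition4p3
    {k : Type*} [Field k] [IsAlgClosed k]
    {V : Type*} [Quiver V] [Finite V] [∀ a b : V, Finite (a ⟶ b)]
    (hV : GBP.IsAcyclicQuiver V)
    {A : V → Type*} [∀ l, Ring (A l)] [∀ l, Algebra k (A l)]
    (P : ∀ l, GBP.BoundPresentation k (A l))
    (I : Set (GBP.Relation k V)) (hI : GBP.IsAdmissible k (GBP.relationIdeal I))
    (i : V) {M : Type*} [AddCommGroup M] [Module k M] [Module (A i)ᵐᵒᵖ M]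
    [IsScalarTower k (A i)ᵐᵒᵖ M] [Module.Finite (A i)ᵐᵒᵖ M]
    {κ : V → Type*} (b : ∀ l, Module.Basis (κ l) k (A l))
    {τ : Type*} (μ : Module.Basis τ k M) :
    -- the vertex `i`
    (∃ f : M ≃ₗ[(A i)ᵐᵒᵖ] GBP.VertexModule P I (GBP.Cone P I i M) i,
      (∀ m, GBP.VertexModule.val P I i (f m) = GBP.Cone.tmul P I i m 1) ∧
      -- the arrows that start at `i`
      ∀ (j' : V) (α : i ⟶ j')
        (φ : GBP.VertexModule P I (GBP.Cone P I i M) i →ₗ[k]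
          GBP.VertexModule P I (GBP.Cone P I i M) j'),
        φ = GBP.arrowMap P I α ↔
          ∀ p : τ, φ (f (μ p)) = GBP.seqClass P I b μ (p, GBP.Word.single α)) ∧
    -- the other vertices
    (∀ j : V, j ≠ i →
      (∃ S : Set (τ × GBP.Word κ i j),
        LinearIndepOn k (GBP.seqClass P I b μ) S ∧
        Submodule.span k (GBP.seqClass P I b μ '' S) =
          Submodule.span k (Set.range (GBP.seqClass P I b μ (j := j)))) ∧
      (∀ S : Set (τ × GBP.Word κ i j),
        LinearIndepOn k (GBP.seqClass P I b μ) S →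
        Submodule.span k (GBP.seqClass P I b μ '' S) =
          Submodule.span k (Set.range (GBP.seqClass P I b μ (j := j))) →
        ∃ B : Module.Basis S (A j)ᵐᵒᵖ (GBP.VertexModule P I (GBP.Cone P I i M) j),
          ∀ s : S, B s = GBP.seqClass P I b μ s.1) ∧
      (GBP.IsMonomial I →
        (∀ s : τ × GBP.Word κ i j, GBP.ContainsRelationPath I s.2.path →
          GBP.seqClass P I b μ s = 0) ∧
        ∃ B : Module.Basis
            {s : τ × GBP.Word κ i j // ¬ GBP.ContainsRelationPath I s.2.path}
            (A j)ᵐᵒᵖ (GBP.VertexModule P I (GBP.Cone P I i M) j),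
          ∀ s, B s = GBP.seqClass P I b μ s.1)) ∧
    -- the arrows that start at another vertex
    (∀ (j j' : V) (α : j ⟶ j'), j ≠ i →
      ∀ φ : GBP.VertexModule P I (GBP.Cone P I i M) j →ₗ[k]
          GBP.VertexModule P I (GBP.Cone P I i M) j',
        φ = GBP.arrowMap P I α ↔
          ∀ (p : τ) (s : GBP.Word κ i j) (c : κ j),
            φ (op (b j c) • GBP.seqClass P I b μ (p, s)) =
              GBP.seqClass P I b μ (p, s.snoc c α)) :=
  proposition4p3_general P I i (hV i) b μ
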